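/- Fix constants $K>0$ and $\varepsilon>0$. For each $n\ge 1$ let $\xi_{ij}=\xi^{(n)}_{ij}$, $1\le i,j\le n$, be independent (not necessarily identically distributed) real random variables, each with mean $0$ and variance $1$, and with $|\xi_{ij}|\le K$ almost surely, where $K$ does not depend on $n$. Let $M_n=(\xi_{ij})_{1\le i,j\le n}$. Then $$\mathbf P\Bigl(|\det M_n|\ \ge\ \sqrt{n!}\,\exp\bigl(-n^{1/2+\varepsilon}\bigr)\Bigr)\ \ge\ 1-o(1)\qquad (n\to\infty),$$ where $o(1)$ denotes a quantity that tends to $0$ as $n\to\infty$ and depends only on $n$, $K$ and $\varepsilon$ (not on the distributions of the entries). -/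

import Mathlib

open MeasureTheory ProbabilityTheory Filter Topology
open scoped Nat

/-!
By Gram–Schmidt, `|det M|` is the product of the heights of the rows, the height of row `i` being
the distance from it to the span of the rows above. The expected square of this height is at least
`n - i`, and the product of the numbers `n - i` is `n!`, so one has to bound the total relative
shortfall of the squared heights below `n - i`.

The squared height is a quadratic form, given by a projection of rank at least `n - i`, in a row
independent of that projection. Its fluctuations have relative size `1 / √(n - i)`, so the expected
total shortfall is `O(√n)`, and by Markov's inequality it is rarely more than `n ^ (1/2 + ε/2)`.

The shortfall controls the determinant up to a factor `log n` in the exponent, provided that no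
height is smaller than a fixed negative power of `n`. Given the rows above it, row `i` is nearly
orthogonal to a whole space of dimension `n - i` when its height is small; eliminating one
coordinate at a time, this has probability at most `p ^ (n - i)` for some `p < 1`. It remains to
treat boundedly many last rows. A union bound over a grid shows that no vector with few nonzero
coordinates is nearly orthogonal to all earlier rows, so a normal vector has many large coordinates,
and its product with row `i` is then spread out by the Littlewood–Offord–Erdős theorem, applied to a
random mixture of two independent copies of the row.
-/

open scoped Matrix ENNReal

section Resampling

variable {ι : Type*} [Fintype ι] [DecidableEq ι] {X : ι → Type*} [∀ i, MeasurableSpace (X i)]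
  (μ : ∀ i, Measure (X i)) [∀ i, IsProbabilityMeasure (μ i)]

theorem lintegral_pi_update {f : (∀ i, X i) → ℝ≥0∞} (hf : Measurable f) (i : ι) :
    ∫⁻ x, f x ∂Measure.pi μ = ∫⁻ x, ∫⁻ y, f (Function.update x i y) ∂μ i ∂Measure.pi μ := by
  have hmarginal : (fun x => ∫⁻ y, f (Function.update x i y) ∂μ i) = ∫⋯∫⁻_{i}, f ∂μ :=
    (lmarginal_singleton f i).symm
  have hmeas : Measurable (fun x => ∫⁻ y, f (Function.update x i y) ∂μ i) :=
    hmarginal ▸ hf.lmarginal μ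
  refine lintegral_eq_of_lmarginal_eq {i} hf hmeas ?_
  ext x
  simp [lmarginal_singleton]

theorem lintegral_pi_le_of_update {f : (∀ i, X i) → ℝ≥0∞} (hf : Measurable f) (i : ι)
    {c : ℝ≥0∞} (h : ∀ x, ∫⁻ y, f (Function.update x i y) ∂μ i ≤ c) :
    ∫⁻ x, f x ∂Measure.pi μ ≤ c := by
  rw [lintegral_pi_update μ hf i]
  exact (lintegral_mono h).trans_eq (by simp)

theorem measureReal_pi_inter_le_mul {E G : Set (∀ i, X i)} (hE : MeasurableSet E)
    (hG : MeasurableSet G) (i : ι) (hEi : ∀ x y, Function.update x i y ∈ E ↔ x ∈ E) {p : ℝ}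
    (hp : 0 ≤ p) (h : ∀ x ∈ E, (μ i).real {y | Function.update x i y ∈ G} ≤ p) :
    (Measure.pi μ).real (E ∩ G) ≤ p * (Measure.pi μ).real E := by
  have hsection (x : ∀ i, X i) :
      ∫⁻ y, (E ∩ G).indicator 1 (Function.update x i y) ∂μ i
        ≤ ENNReal.ofReal p * E.indicator 1 x := by
    by_cases hx : x ∈ E
    · have hind : (fun y => (E ∩ G).indicator (1 : (∀ i, X i) → ℝ≥0∞) (Function.update x i y)) =
          {y | Function.update x i y ∈ G}.indicator 1 := by
        funext y
        by_cases hy : Function.update x i y ∈ G <;> simp [hEi, hx, hy]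
      rw [hind, lintegral_indicator_one (s := {y | Function.update x i y ∈ G})
        (measurable_update x hG), ← ofReal_measureReal]
      simpa [hx] using ENNReal.ofReal_le_ofReal (h x hx)
    · simp [hEi, hx]
  have hmul : Measure.pi μ (E ∩ G) ≤ ENNReal.ofReal p * Measure.pi μ E := by
    rw [← lintegral_indicator_one (hE.inter hG),
      lintegral_pi_update μ (measurable_one.indicator (hE.inter hG)) i,
      ← lintegral_indicator_one hE, ← lintegral_const_mul _ (measurable_one.indicator hE)]
    exact lintegral_mono hsection
  have := ENNReal.toReal_mono (by finiteness) hmul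
  rwa [ENNReal.toReal_mul, ENNReal.toReal_ofReal hp] at this

end Resampling

theorem measureReal_le_le_of_ae_le {Ω : Type*} [MeasurableSpace Ω] {μ : Measure Ω}
    [IsProbabilityMeasure μ] {Z : Ω → ℝ} {a b : ℝ} (hZ : Integrable Z μ)
    (hb : ∀ᵐ ω ∂μ, Z ω ≤ b) (hab : a < b) :
    μ.real {ω | Z ω ≤ a} ≤ (b - ∫ ω, Z ω ∂μ) / (b - a) := by
  have hmarkov := mul_meas_ge_le_integral_of_nonneg (μ := μ) (f := fun ω => b - Z ω)
    (hb.mono fun ω hω => sub_nonneg.2 hω) ((integrable_const b).sub hZ) (b - a)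
  rw [integral_sub (integrable_const b) hZ] at hmarkov
  rw [le_div_iff₀' (sub_pos.2 hab)]
  simpa only [sub_le_sub_iff_left, integral_const, probReal_univ, one_smul] using hmarkov

theorem measureReal_ge_le_cantelli {Ω : Type*} [MeasurableSpace Ω] {μ : Measure Ω}
    [IsProbabilityMeasure μ] {T : Ω → ℝ} (hT : MemLp T 2 μ) (hmean : ∫ ω, T ω ∂μ = 0) {s a : ℝ}
    (hs : ∫ ω, T ω ^ 2 ∂μ ≤ s) (ha : 0 < a) :
    μ.real {ω | a ≤ T ω} ≤ s / (s + a ^ 2) := by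
  have hs0 : 0 ≤ s := (integral_nonneg fun ω => sq_nonneg (T ω)).trans hs
  -- `b = s / a` is the shift that optimises Markov's inequality for `(T + b) ^ 2`.
  obtain ⟨b, rfl⟩ : ∃ b, s = b * a := ⟨s / a, by field_simp⟩
  have hb : 0 ≤ b := nonneg_of_mul_nonneg_left hs0 ha
  have hT1 : Integrable T μ := hT.integrable one_le_two
  have hsq : Integrable (fun ω => (T ω + b) ^ 2) μ := (hT.add (memLp_const b)).integrable_sq
  have hsecond : ∫ ω, (T ω + b) ^ 2 ∂μ ≤ b * (a + b) := by
    have hexp (ω : Ω) : (T ω + b) ^ 2 = T ω ^ 2 + (2 * b * T ω + b ^ 2) := by ring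
    simp_rw [hexp]
    rw [integral_add hT.integrable_sq (by fun_prop), integral_add (by fun_prop) (by fun_prop),
      integral_const_mul, hmean]
    simp only [integral_const, probReal_univ, smul_eq_mul]
    linarith
  have hmarkov : (a + b) ^ 2 * μ.real {ω | a ≤ T ω} ≤ b * (a + b) := by
    calc (a + b) ^ 2 * μ.real {ω | a ≤ T ω}
        ≤ (a + b) ^ 2 * μ.real {ω | (a + b) ^ 2 ≤ (T ω + b) ^ 2} := by
          refine mul_le_mul_of_nonneg_left (measureReal_mono fun ω hω => ?_) (sq_nonneg _)
          exact pow_le_pow_left₀ (by positivity) (add_le_add_left hω b) 2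
      _ ≤ ∫ ω, (T ω + b) ^ 2 ∂μ :=
          mul_meas_ge_le_integral_of_nonneg (ae_of_all _ fun ω => sq_nonneg (T ω + b)) hsq _
      _ ≤ b * (a + b) := hsecond
  have hab : 0 < a + b := by positivity
  rw [show b * a + a ^ 2 = (a + b) * a by ring, mul_div_mul_right _ _ ha.ne', le_div_iff₀' hab]
  refine le_of_mul_le_mul_left ?_ hab
  linarith

theorem integral_abs_le_sqrt_integral_sq {Ω : Type*} [MeasurableSpace Ω] {μ : Measure Ω}
    [IsProbabilityMeasure μ] {T : Ω → ℝ} (hT : MemLp T 2 μ) :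
    ∫ ω, |T ω| ∂μ ≤ √(∫ ω, T ω ^ 2 ∂μ) := by
  refine Real.le_sqrt_of_sq_le ?_
  have hvar := variance_nonneg |T| μ
  rw [variance_eq_sub hT.abs] at hvar
  simpa using hvar

/-- The laws of the admissible entries: mean `0`, variance `1`, supported in `[-K, K]`. -/
structure StandardLaw (K : ℝ) where
  toMeasure : Measure ℝ
  [isProbabilityMeasure : IsProbabilityMeasure toMeasure]
  ae_abs_le : ∀ᵐ x ∂toMeasure, |x| ≤ K
  integral_id_eq_zero : ∫ x, x ∂toMeasure = 0
  integral_sq_eq_one : ∫ x, x ^ 2 ∂toMeasure = 1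

attribute [instance] StandardLaw.isProbabilityMeasure

/-- The single constant bounding every small ball probability below: a standardised law bounded by
`K` gives mass at most `concentrationRate K` to a ball of radius `1 / 2`, and a linear form in such
variables is within `1 / √2` standard deviations of `0` with at most this probability. -/
noncomputable def concentrationRate (K : ℝ) : ℝ := 1 - 1 / (8 * K ^ 2 + 2)

theorem half_le_concentrationRate (K : ℝ) : 1 / 2 ≤ concentrationRate K := by
  have : 1 / (8 * K ^ 2 + 2) ≤ 1 / 2 := by gcongr; nlinarith [sq_nonneg K]
  unfold concentrationRate
  linarith

theorem concentrationRate_pos (K : ℝ) : 0 < concentrationRate K := by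
  linarith [half_le_concentrationRate K]

theorem concentrationRate_lt_one (K : ℝ) : concentrationRate K < 1 :=
  sub_lt_self _ (by positivity)

namespace StandardLaw

variable {K : ℝ}

theorem nonneg_bound (ν : StandardLaw K) : 0 ≤ K := by
  obtain ⟨x, hx⟩ := ν.ae_abs_le.exists
  exact (abs_nonneg x).trans hx

theorem integrable_of_continuous (ν : StandardLaw K) {f : ℝ → ℝ} (hf : Continuous f) :
    Integrable f ν.toMeasure := by
  obtain ⟨C, hC⟩ := (isCompact_Icc (a := -K) (b := K)).exists_bound_of_continuousOn hf.continuousOn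
  refine Integrable.of_bound hf.aestronglyMeasurable C ?_
  filter_upwards [ν.ae_abs_le] with x hx
  exact hC x (abs_le.1 hx)

theorem ae_sq_le (ν : StandardLaw K) : ∀ᵐ x ∂ν.toMeasure, x ^ 2 ≤ K ^ 2 :=
  ν.ae_abs_le.mono fun _ hx => sq_le_sq.2 (hx.trans (le_abs_self K))

theorem one_le_sq_bound (ν : StandardLaw K) : 1 ≤ K ^ 2 := by
  have := integral_mono_ae (ν.integrable_of_continuous (by fun_prop))
    (integrable_const (K ^ 2)) ν.ae_sq_le
  simpa [ν.integral_sq_eq_one] using this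

theorem one_le_bound (ν : StandardLaw K) : 1 ≤ K := by
  nlinarith [ν.one_le_sq_bound, ν.nonneg_bound]

theorem integral_sq_sub_one (ν : StandardLaw K) : ∫ x, (x ^ 2 - 1) ∂ν.toMeasure = 0 := by
  rw [integral_sub (ν.integrable_of_continuous (by fun_prop)) (integrable_const _),
    ν.integral_sq_eq_one]
  simp

theorem integral_sq_sub_one_sq_le (ν : StandardLaw K) :
    ∫ x, (x ^ 2 - 1) ^ 2 ∂ν.toMeasure ≤ K ^ 2 := by
  calc ∫ x, (x ^ 2 - 1) ^ 2 ∂ν.toMeasure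
      ≤ ∫ x, ((K ^ 2 - 2) * x ^ 2 + 1) ∂ν.toMeasure := by
        refine integral_mono_ae (ν.integrable_of_continuous (by fun_prop))
          (ν.integrable_of_continuous (by fun_prop)) ?_
        filter_upwards [ν.ae_sq_le] with x hx
        nlinarith [sq_nonneg x]
    _ = K ^ 2 - 1 := by
        rw [integral_add (ν.integrable_of_continuous (by fun_prop)) (integrable_const _),
          integral_const_mul, ν.integral_sq_eq_one]
        simp only [integral_const, probReal_univ, smul_eq_mul]
        ring
    _ ≤ K ^ 2 := by linarith

theorem integral_sub_sq (ν : StandardLaw K) (x : ℝ) :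
    ∫ y, (y - x) ^ 2 ∂ν.toMeasure = 1 + x ^ 2 := by
  have hexp (y : ℝ) : (y - x) ^ 2 = y ^ 2 + (-2 * x * y + x ^ 2) := by ring
  simp_rw [hexp]
  rw [integral_add (ν.integrable_of_continuous (by fun_prop))
      (ν.integrable_of_continuous (by fun_prop)),
    integral_add (ν.integrable_of_continuous (by fun_prop)) (integrable_const _),
    integral_const_mul, ν.integral_id_eq_zero, ν.integral_sq_eq_one]
  simp

theorem measureReal_closedBall_le (ν : StandardLaw K) (x : ℝ) :
    ν.toMeasure.real (Metric.closedBall x (1 / 2)) ≤ concentrationRate K := by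
  have hK := ν.one_le_bound
  have hbound : ∀ᵐ y ∂ν.toMeasure, (y - x) ^ 2 ≤ 2 * K ^ 2 + 2 * x ^ 2 := by
    filter_upwards [ν.ae_sq_le] with y hy
    nlinarith [sq_nonneg (y + x)]
  have hball : Metric.closedBall x (1 / 2) = {y : ℝ | (y - x) ^ 2 ≤ 1 / 4} := by
    ext y
    rw [Metric.mem_closedBall, Real.dist_eq, Set.mem_ofPred_eq,
      show (1 / 4 : ℝ) = (1 / 2) ^ 2 by norm_num, sq_le_sq, abs_of_pos (one_half_pos (α := ℝ))]
  calc ν.toMeasure.real (Metric.closedBall x (1 / 2))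
      ≤ (2 * K ^ 2 + 2 * x ^ 2 - (1 + x ^ 2)) / (2 * K ^ 2 + 2 * x ^ 2 - 1 / 4) := by
        rw [hball, ← ν.integral_sub_sq x]
        exact measureReal_le_le_of_ae_le (ν.integrable_of_continuous (by fun_prop)) hbound
          (by nlinarith)
    _ ≤ concentrationRate K := by
        rw [concentrationRate, div_le_iff₀ (by nlinarith)]
        field_simp
        nlinarith [sq_nonneg x, mul_nonneg (sq_nonneg K) (sq_nonneg x)]

variable {ι κ : Type*} [Fintype ι] [Fintype κ]

/-- The law of a random vector with independent entries of laws `ν j`. -/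
noncomputable abbrev vectorLaw (ν : ι → StandardLaw K) : Measure (ι → ℝ) :=
  Measure.pi fun j => (ν j).toMeasure

/-- The law of a random matrix with independent entries of laws `ν i j`, as a product over rows. -/
noncomputable abbrev matrixLaw (ν : ι → κ → StandardLaw K) : Measure (ι → κ → ℝ) :=
  Measure.pi fun i => vectorLaw (ν i)

end StandardLaw

section Chaos

variable {ι : Type*} [DecidableEq ι]

/-- The factor at coordinate `m` of the polynomial `chaos z`. -/
noncomputable def chaosFactor (z : Sym2 ι) (m : ι) (x : ℝ) : ℝ :=
  if z = s(m, m) then x ^ 2 - 1 else if m ∈ z then x else 1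

theorem continuous_chaosFactor (z : Sym2 ι) (m : ι) : Continuous (chaosFactor z m) := by
  unfold chaosFactor
  split_ifs <;> fun_prop

theorem chaosFactor_of_notMem {z : Sym2 ι} {m : ι} (hm : m ∉ z) (x : ℝ) :
    chaosFactor z m x = 1 := by
  have hz : z ≠ s(m, m) := fun h => hm (h ▸ Sym2.mem_mk_left m m)
  simp [chaosFactor, hm, hz]

variable {K : ℝ}

theorem integral_chaosFactor_eq_zero (ν : ι → StandardLaw K) {z : Sym2 ι} {m : ι} (hm : m ∈ z) :
    ∫ y, chaosFactor z m y ∂(ν m).toMeasure = 0 := by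
  by_cases hz : z = s(m, m)
  · simpa [chaosFactor, hz] using (ν m).integral_sq_sub_one
  · simpa [chaosFactor, hz, hm] using (ν m).integral_id_eq_zero

variable [Fintype ι]

/-- The polynomials `x i * x j` for `i ≠ j` and `x i ^ 2 - 1` for `i = j`, indexed by unordered
pairs `s(i, j)`: they are orthogonal under every product of standardised laws. -/
noncomputable def chaos (z : Sym2 ι) (x : ι → ℝ) : ℝ :=
  ∏ m, chaosFactor z m (x m)

theorem chaos_mk (i j : ι) (x : ι → ℝ) :
    chaos s(i, j) x = x i * x j - if i = j then 1 else 0 := by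
  by_cases hij : i = j
  · subst hij
    rw [chaos, Finset.prod_eq_single i (fun m _ hm => chaosFactor_of_notMem (by simpa using hm) _)
      (by simp)]
    simp [chaosFactor, sq]
  · rw [chaos, Finset.prod_eq_mul i j hij
      (fun m _ hm => chaosFactor_of_notMem (by simpa using hm) _) (by simp) (by simp)]
    simp [chaosFactor, hij, Ne.symm hij]

variable (ν : ι → StandardLaw K)

theorem memLp_chaos (z : Sym2 ι) : MemLp (chaos z) 2 (StandardLaw.vectorLaw ν) := by
  refine (memLp_two_iff_integrable_sq ?_).2 ?_
  · exact (continuous_finsetProd _ fun m _ =>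
      (continuous_chaosFactor z m).comp (continuous_apply m)).aestronglyMeasurable
  · simp_rw [chaos, ← Finset.prod_pow]
    exact Integrable.fintype_prod (f := fun m y => chaosFactor z m y ^ 2) fun m =>
      (ν m).integrable_of_continuous ((continuous_chaosFactor z m).pow 2)

theorem integral_chaos_mul_chaos (z w : Sym2 ι) :
    ∫ x, chaos z x * chaos w x ∂StandardLaw.vectorLaw ν =
      ∏ m, ∫ y, chaosFactor z m y * chaosFactor w m y ∂(ν m).toMeasure := by
  simp_rw [chaos, ← Finset.prod_mul_distrib]
  exact integral_fintype_prod_eq_prod fun m y => chaosFactor z m y * chaosFactor w m y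

theorem integral_chaos_eq_zero (z : Sym2 ι) : ∫ x, chaos z x ∂StandardLaw.vectorLaw ν = 0 := by
  obtain ⟨m, hm⟩ : ∃ m, m ∈ z := ⟨_, Sym2.out_fst_mem z⟩
  simp_rw [chaos]
  rw [integral_fintype_prod_eq_prod (chaosFactor z)]
  exact Finset.prod_eq_zero (Finset.mem_univ m) (integral_chaosFactor_eq_zero ν hm)

theorem integral_chaos_mul_chaos_of_ne {z w : Sym2 ι} (hzw : z ≠ w) :
    ∫ x, chaos z x * chaos w x ∂StandardLaw.vectorLaw ν = 0 := by
  obtain ⟨m, hm⟩ : ∃ m, ¬ (m ∈ z ↔ m ∈ w) := by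
    by_contra! h
    exact hzw (Sym2.ext h)
  rw [integral_chaos_mul_chaos]
  refine Finset.prod_eq_zero (Finset.mem_univ m) ?_
  by_cases hz : m ∈ z
  · have hw : m ∉ w := fun hw => hm ⟨fun _ => hw, fun _ => hz⟩
    simpa only [chaosFactor_of_notMem hw, mul_one] using integral_chaosFactor_eq_zero ν hz
  · have hw : m ∈ w := by tauto
    simpa only [chaosFactor_of_notMem hz, one_mul] using integral_chaosFactor_eq_zero ν hw

theorem integral_chaos_sq_le (z : Sym2 ι) :
    ∫ x, chaos z x * chaos z x ∂StandardLaw.vectorLaw ν ≤ K ^ 2 := by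
  induction z using Sym2.ind with | _ i j
  rw [integral_chaos_mul_chaos]
  by_cases hij : i = j
  · subst hij
    rw [Finset.prod_eq_single i]
    · simpa [chaosFactor, ← sq] using (ν i).integral_sq_sub_one_sq_le
    · intro m _ hm
      simp [chaosFactor_of_notMem (z := s(i, i)) (by simpa using hm)]
    · simp
  · refine le_of_eq_of_le (Finset.prod_eq_one fun m _ => ?_) (ν i).one_le_sq_bound
    by_cases hm : m ∈ s(i, j)
    · have hdiag : s(i, j) ≠ s(m, m) := by
        rintro h
        simp_all
      simpa [chaosFactor, hdiag, hm, ← sq] using (ν m).integral_sq_eq_one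
    · simp [chaosFactor_of_notMem hm]

end Chaos

section CenteredForm

variable {ι : Type*} [Fintype ι]

/-- The quadratic form `x ↦ xᵀ A x` minus its mean under a product of standardised laws. -/
def centeredForm (A : Matrix ι ι ℝ) (x : ι → ℝ) : ℝ :=
  x ⬝ᵥ A *ᵥ x - A.trace

theorem centeredForm_eq_sum_chaos [DecidableEq ι] (A : Matrix ι ι ℝ) :
    centeredForm A = fun x => ∑ p : ι × ι, A p.1 p.2 * chaos s(p.1, p.2) x := by
  funext x
  simp_rw [chaos_mk, mul_sub, Finset.sum_sub_distrib, Fintype.sum_prod_type]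
  simp only [centeredForm, dotProduct, Matrix.mulVec, Matrix.trace, Matrix.diag, Finset.mul_sum,
    mul_ite, mul_one, mul_zero, Finset.sum_ite_eq, Finset.mem_univ, if_true]
  congr 1
  exact Finset.sum_congr rfl fun i _ => Finset.sum_congr rfl fun j _ => mul_left_comm ..

variable {K : ℝ} (ν : ι → StandardLaw K) (A : Matrix ι ι ℝ)

theorem memLp_centeredForm : MemLp (centeredForm A) 2 (StandardLaw.vectorLaw ν) := by
  classical
  rw [centeredForm_eq_sum_chaos]
  exact memLp_finsetSum _ fun p _ => (memLp_chaos ν _).const_mul _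

theorem integral_centeredForm : ∫ x, centeredForm A x ∂StandardLaw.vectorLaw ν = 0 := by
  classical
  rw [centeredForm_eq_sum_chaos, integral_finsetSum _ fun p _ =>
    ((memLp_chaos ν _).integrable one_le_two).const_mul _]
  simp_rw [integral_const_mul, integral_chaos_eq_zero, mul_zero, Finset.sum_const_zero]

theorem sum_sum_mul_mul_le_of_schur_test {α : Type*} [Fintype α] {G : α → α → ℝ} {B : ℝ}
    (hsymm : ∀ p q, G p q = G q p) (hG : ∀ p, ∑ q, |G p q| ≤ B) (a : α → ℝ) :
    ∑ p, ∑ q, a p * a q * G p q ≤ B * ∑ p, a p ^ 2 := by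
  have hswap : ∑ p, ∑ q, |G p q| * a q ^ 2 = ∑ p, ∑ q, |G p q| * a p ^ 2 := by
    rw [Finset.sum_comm]
    simp_rw [hsymm]
  calc ∑ p, ∑ q, a p * a q * G p q
      ≤ ∑ p, ∑ q, (|G p q| * a p ^ 2 + |G p q| * a q ^ 2) / 2 := by
        gcongr with p _ q _
        have hmul : a p * a q * G p q ≤ |a p * a q| * |G p q| := by
          rw [← abs_mul]
          exact le_abs_self _
        have hamgm : |a p * a q| ≤ (a p ^ 2 + a q ^ 2) / 2 := by
          rw [abs_le]
          constructor <;> nlinarith [sq_nonneg (a p + a q), sq_nonneg (a p - a q)]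
        nlinarith [mul_le_mul_of_nonneg_right hamgm (abs_nonneg (G p q))]
    _ = ∑ p, ∑ q, |G p q| * a p ^ 2 := by
        simp_rw [← Finset.sum_div, Finset.sum_add_distrib, hswap]
        ring
    _ ≤ ∑ p, B * a p ^ 2 := by
        gcongr with p _
        rw [← Finset.sum_mul]
        exact mul_le_mul_of_nonneg_right (hG p) (sq_nonneg _)
    _ = B * ∑ p, a p ^ 2 := (Finset.mul_sum ..).symm

theorem card_filter_sym2_mk_eq_le [DecidableEq ι] (z : Sym2 ι) :
    (Finset.univ.filter fun q : ι × ι => z = s(q.1, q.2)).card ≤ 2 := by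
  induction z using Sym2.ind with | _ i j
  have hsub : (Finset.univ.filter fun q : ι × ι => s(i, j) = s(q.1, q.2)) ⊆
      {(i, j), (j, i)} := by
    intro q hq
    simp only [Finset.mem_filter, Finset.mem_univ, true_and, Sym2.eq_iff] at hq
    rcases hq with h | h <;> simp [Prod.ext_iff, h]
  exact (Finset.card_le_card hsub).trans Finset.card_le_two

theorem sum_abs_integral_chaos_mul_chaos_le [DecidableEq ι] (z : Sym2 ι) :
    ∑ q : ι × ι, |∫ x, chaos z x * chaos s(q.1, q.2) x ∂StandardLaw.vectorLaw ν| ≤ 2 * K ^ 2 := by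
  calc ∑ q : ι × ι, |∫ x, chaos z x * chaos s(q.1, q.2) x ∂StandardLaw.vectorLaw ν|
      ≤ ∑ q : ι × ι, if z = s(q.1, q.2) then K ^ 2 else 0 := by
        gcongr with q _
        split_ifs with h
        · rw [← h, abs_of_nonneg (integral_nonneg fun x => mul_self_nonneg _)]
          exact integral_chaos_sq_le ν z
        · rw [integral_chaos_mul_chaos_of_ne ν h, abs_zero]
    _ = (Finset.univ.filter fun q : ι × ι => z = s(q.1, q.2)).card * K ^ 2 := by
        rw [← Finset.sum_filter, Finset.sum_const, nsmul_eq_mul]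
    _ ≤ 2 * K ^ 2 := by
        gcongr
        exact_mod_cast card_filter_sym2_mk_eq_le z

theorem integral_centeredForm_sq_le :
    ∫ x, centeredForm A x ^ 2 ∂StandardLaw.vectorLaw ν ≤ 2 * K ^ 2 * ∑ i, ∑ j, A i j ^ 2 := by
  classical
  have hint (p q : ι × ι) : Integrable (fun x => A p.1 p.2 * A q.1 q.2 *
      (chaos s(p.1, p.2) x * chaos s(q.1, q.2) x)) (StandardLaw.vectorLaw ν) :=
    ((memLp_chaos ν _).integrable_mul (memLp_chaos ν _)).const_mul _
  have hexpand : ∫ x, centeredForm A x ^ 2 ∂StandardLaw.vectorLaw ν =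
      ∑ p : ι × ι, ∑ q : ι × ι, A p.1 p.2 * A q.1 q.2 *
        ∫ x, chaos s(p.1, p.2) x * chaos s(q.1, q.2) x ∂StandardLaw.vectorLaw ν := by
    simp_rw [centeredForm_eq_sum_chaos, sq, Finset.sum_mul_sum, mul_mul_mul_comm]
    rw [integral_finsetSum _ fun p _ => integrable_finsetSum _ fun q _ => hint p q]
    simp_rw [integral_finsetSum _ fun q _ => hint _ q, integral_const_mul]
  rw [hexpand, ← Fintype.sum_prod_type' fun i j => A i j ^ 2]
  exact sum_sum_mul_mul_le_of_schur_test (fun p q => by simp_rw [mul_comm (chaos s(p.1, p.2) _)])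
    (fun p => sum_abs_integral_chaos_mul_chaos_le ν _) fun p : ι × ι => A p.1 p.2

theorem integral_abs_centeredForm_le :
    ∫ x, |centeredForm A x| ∂StandardLaw.vectorLaw ν ≤ √(2 * K ^ 2 * ∑ i, ∑ j, A i j ^ 2) :=
  (integral_abs_le_sqrt_integral_sq (memLp_centeredForm ν A)).trans
    (Real.sqrt_le_sqrt (integral_centeredForm_sq_le ν A))

theorem measureReal_dotProduct_sq_le {u : ι → ℝ} (hu : u ≠ 0) :
    (StandardLaw.vectorLaw ν).real {x | (u ⬝ᵥ x) ^ 2 ≤ (u ⬝ᵥ u) / 2} ≤ concentrationRate K := by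
  have hS : 0 < u ⬝ᵥ u := by
    simpa using Matrix.dotProduct_star_self_pos_iff.2 hu
  have hform (x : ι → ℝ) : centeredForm (Matrix.vecMulVec u u) x = (u ⬝ᵥ x) ^ 2 - u ⬝ᵥ u := by
    rw [centeredForm, Matrix.vecMulVec_mulVec, Matrix.trace_vecMulVec, op_smul_eq_smul,
      dotProduct_smul, dotProduct_comm x, smul_eq_mul, sq]
  have hsecond : ∑ i, ∑ j, Matrix.vecMulVec u u i j ^ 2 = (u ⬝ᵥ u) ^ 2 := by
    simp_rw [Matrix.vecMulVec_apply, mul_pow, sq (u ⬝ᵥ u), dotProduct, Finset.sum_mul_sum, ← sq]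
  have hset : {x | (u ⬝ᵥ x) ^ 2 ≤ (u ⬝ᵥ u) / 2} =
      {x | (u ⬝ᵥ u) / 2 ≤ (-centeredForm (Matrix.vecMulVec u u)) x} := by
    ext x
    simp only [Set.mem_ofPred_eq, Pi.neg_apply, hform]
    constructor <;> intro h <;> linarith
  have hcantelli := measureReal_ge_le_cantelli (memLp_centeredForm ν (Matrix.vecMulVec u u)).neg
    (by simp [integral_neg, integral_centeredForm])
    (by simpa [hsecond] using integral_centeredForm_sq_le ν (Matrix.vecMulVec u u)) (half_pos hS)
  rw [hset]
  calc _ ≤ _ := hcantelli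
    _ = 1 - 1 / (8 * K ^ 2 + 1) := by
        field_simp
        ring
    _ ≤ concentrationRate K := by
        unfold concentrationRate
        gcongr
        norm_num

theorem lintegral_one_sub_dotProduct_mulVec_div_le {D : ℝ} (hD : 0 < D) (htrace : A.trace = D)
    (hfrobenius : ∑ i, ∑ j, A i j ^ 2 = D) :
    ∫⁻ x, ENNReal.ofReal (1 - (x ⬝ᵥ A *ᵥ x) / D) ∂StandardLaw.vectorLaw ν ≤
      ENNReal.ofReal (√2 * |K| / √D) := by
  have hint : Integrable (fun x => |centeredForm A x| / D) (StandardLaw.vectorLaw ν) :=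
    ((memLp_centeredForm ν A).integrable one_le_two).abs.div_const D
  calc ∫⁻ x, ENNReal.ofReal (1 - (x ⬝ᵥ A *ᵥ x) / D) ∂StandardLaw.vectorLaw ν
      ≤ ∫⁻ x, ENNReal.ofReal (|centeredForm A x| / D) ∂StandardLaw.vectorLaw ν := by
        gcongr with x
        rw [one_sub_div hD.ne', centeredForm, htrace]
        gcongr
        exact (neg_sub (x ⬝ᵥ A *ᵥ x) D).symm.trans_le (neg_le_abs _)
    _ = ENNReal.ofReal (∫ x, |centeredForm A x| / D ∂StandardLaw.vectorLaw ν) :=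
        (ofReal_integral_eq_lintegral_ofReal hint (ae_of_all _ fun x => by positivity)).symm
    _ ≤ ENNReal.ofReal (√(2 * K ^ 2 * D) / D) := by
        rw [integral_div, ← hfrobenius]
        gcongr
        exact integral_abs_centeredForm_le ν A
    _ = ENNReal.ofReal (√2 * |K| / √D) := by
        rw [Real.sqrt_mul (by positivity), Real.sqrt_mul zero_le_two, Real.sqrt_sq_eq_abs,
          mul_div_assoc, Real.sqrt_div_self', mul_one_div]

end CenteredForm

section Subspace

variable {ι : Type*}

theorem exists_submodule_apply_eq_zero [Finite ι] {d : ℕ} {V : Submodule ℝ (ι → ℝ)}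
    (hV : d + 1 ≤ Module.finrank ℝ V) (j : ι) :
    ∃ V' ≤ V, (∀ v ∈ V', v j = 0) ∧ d ≤ Module.finrank ℝ V' := by
  let f : V →ₗ[ℝ] ℝ := (LinearMap.proj j).domRestrict V
  refine ⟨(LinearMap.ker f).map V.subtype, Submodule.map_subtype_le _ _, ?_, ?_⟩
  · rintro _ ⟨v, hv, rfl⟩
    exact hv
  · have hrank := LinearMap.finrank_range_add_finrank_ker f
    have hrange : Module.finrank ℝ (LinearMap.range f) ≤ 1 := by
      simpa using Submodule.finrank_le (LinearMap.range f)
    rw [Submodule.finrank_map_subtype_eq]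
    lia

variable [Fintype ι]

theorem exists_mem_apply_eq_one_norm_le_one {V : Submodule ℝ (ι → ℝ)} (hV : V ≠ ⊥) :
    ∃ v ∈ V, ∃ j, v j = 1 ∧ ‖v‖ ≤ 1 := by
  obtain ⟨v, hv, hv0⟩ := V.ne_bot_iff.1 hV
  obtain ⟨i, hi⟩ := Function.ne_iff.1 hv0
  obtain ⟨j, -, hj⟩ := Finset.exists_max_image Finset.univ (fun k => |v k|) ⟨i, Finset.mem_univ i⟩
  have hj0 : 0 < |v j| := (abs_pos.2 hi).trans_le (hj i (Finset.mem_univ i))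
  refine ⟨(v j)⁻¹ • v, V.smul_mem _ hv, j, inv_mul_cancel₀ (abs_pos.1 hj0), ?_⟩
  refine (pi_norm_le_iff_of_nonneg zero_le_one).2 fun k => ?_
  rw [Pi.smul_apply, norm_smul, norm_inv, Real.norm_eq_abs, Real.norm_eq_abs,
    inv_mul_le_iff₀ hj0, mul_one]
  exact hj k (Finset.mem_univ k)

theorem dotProduct_update [DecidableEq ι] (v x : ι → ℝ) (j : ι) (y : ℝ) :
    v ⬝ᵥ Function.update x j y = v ⬝ᵥ x + v j * (y - x j) := by
  have hsplit : Function.update x j y = x + Pi.single j (y - x j) := by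
    ext k
    rcases eq_or_ne k j with rfl | hk <;> simp [*]
  rw [hsplit, dotProduct_add, dotProduct_single]

theorem measurableSet_forall_mem_abs_dotProduct_le (V : Submodule ℝ (ι → ℝ)) (r : ℝ) :
    MeasurableSet {x : ι → ℝ | ∀ v ∈ V, |v ⬝ᵥ x| ≤ r * ‖v‖} := by
  simp only [Set.ofPred_forall]
  exact (isClosed_iInter fun v => isClosed_iInter fun _ =>
    isClosed_le (by fun_prop) (by fun_prop)).measurableSet

variable {ν : ι → Measure ℝ} [∀ j, IsProbabilityMeasure (ν j)] {p r : ℝ}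

theorem measureReal_forall_mem_abs_dotProduct_le (hr : 0 ≤ r)
    (hν : ∀ j x, (ν j).real (Metric.closedBall x r) ≤ p) {d : ℕ} {V : Submodule ℝ (ι → ℝ)}
    (hd : d ≤ Module.finrank ℝ V) :
    (Measure.pi ν).real {x | ∀ v ∈ V, |v ⬝ᵥ x| ≤ r * ‖v‖} ≤ p ^ d := by
  classical
  induction d generalizing V with
  | zero => simp
  | succ d ih =>
    have hV : V ≠ ⊥ := by
      rintro rfl
      simp at hd
    obtain ⟨v, hv, j, hvj, hvnorm⟩ := exists_mem_apply_eq_one_norm_le_one hV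
    obtain ⟨V', hV', hV'j, hV'd⟩ := exists_submodule_apply_eq_zero hd j
    have hp : 0 ≤ p := measureReal_nonneg.trans (hν j 0)
    have hsub : {x : ι → ℝ | ∀ v ∈ V, |v ⬝ᵥ x| ≤ r * ‖v‖} ⊆
        {x | ∀ v ∈ V', |v ⬝ᵥ x| ≤ r * ‖v‖} ∩ {x | |v ⬝ᵥ x| ≤ r} := fun x hx =>
      ⟨fun w hw => hx w (hV' hw), (hx v hv).trans (mul_le_of_le_one_right hr hvnorm)⟩
    have hindep (x : ι → ℝ) (y : ℝ) : Function.update x j y ∈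
        {x | ∀ v ∈ V', |v ⬝ᵥ x| ≤ r * ‖v‖} ↔ x ∈ {x | ∀ v ∈ V', |v ⬝ᵥ x| ≤ r * ‖v‖} := by
      refine forall₂_congr fun w hw => ?_
      rw [dotProduct_update, hV'j w hw, zero_mul, add_zero]
    have hcond (x : ι → ℝ) : (ν j).real {y | Function.update x j y ∈ {x | |v ⬝ᵥ x| ≤ r}} ≤ p := by
      convert hν j (x j - v ⬝ᵥ x) using 2
      ext y
      rw [Set.mem_ofPred_eq, Set.mem_ofPred_eq, dotProduct_update, hvj, one_mul,
        Metric.mem_closedBall, Real.dist_eq, ← sub_add, sub_add_eq_add_sub, add_sub_assoc',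
        add_comm]
    calc (Measure.pi ν).real {x | ∀ v ∈ V, |v ⬝ᵥ x| ≤ r * ‖v‖}
        ≤ p * (Measure.pi ν).real {x | ∀ v ∈ V', |v ⬝ᵥ x| ≤ r * ‖v‖} :=
          (measureReal_mono hsub).trans <| measureReal_pi_inter_le_mul ν
            (measurableSet_forall_mem_abs_dotProduct_le V' r)
            (measurableSet_le (by fun_prop) measurable_const) j hindep hp fun x _ => hcond x
      _ ≤ p * p ^ d := by gcongr; exact ih hV'd
      _ = p ^ (d + 1) := (pow_succ' p d).symm

end Subspace

section LittlewoodOfford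

variable {α : Type*} {a : α → ℝ} {c r : ℝ}

theorem isAntichain_of_abs_add_sum_le (ha : ∀ i, 2 * r < a i) {F : Set (Finset α)}
    (hF : ∀ A ∈ F, |c + ∑ i ∈ A, a i| ≤ r) : IsAntichain (· ⊆ ·) F := by
  intro A hA A' hA' hne hsub
  obtain ⟨i, hi', hi⟩ := Finset.exists_of_ssubset (Finset.ssubset_iff_subset_ne.2 ⟨hsub, hne⟩)
  have hr : 0 ≤ r := (abs_nonneg _).trans (hF A hA)
  have hstep : a i + ∑ j ∈ A, a j ≤ ∑ j ∈ A', a j := by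
    rw [← Finset.sum_cons hi]
    refine Finset.sum_le_sum_of_subset_of_nonneg ?_ fun j _ _ => by linarith [ha j]
    exact Finset.cons_subset.2 ⟨hi', hsub⟩
  linarith [(abs_le.1 (hF A hA)).1, (abs_le.1 (hF A' hA')).2, ha i]

theorem sum_eq_sum_symmDiff_abs_sub [Finite α] [DecidableEq α] {N : Finset α}
    (hN : ∀ i, i ∈ N ↔ a i < 0) (A : Finset α) :
    ∑ i ∈ A, a i = ∑ i ∈ symmDiff A N, |a i| - ∑ i ∈ N, |a i| := by
  cases nonempty_fintype α
  rw [← Fintype.sum_ite_mem A, ← Fintype.sum_ite_mem (symmDiff A N), ← Fintype.sum_ite_mem N,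
    ← Finset.sum_sub_distrib]
  refine Finset.sum_congr rfl fun i _ => ?_
  rcases lt_or_ge (a i) 0 with h | h <;> by_cases hA : i ∈ A
  · simp [Finset.mem_symmDiff, hN, hA, h, abs_of_neg h]
  · simp [Finset.mem_symmDiff, hN, hA, h]
  · simp [Finset.mem_symmDiff, hN, hA, h.not_gt, abs_of_nonneg h]
  · simp [Finset.mem_symmDiff, hN, hA, h.not_gt]

theorem card_le_choose_of_abs_add_sum_le [Fintype α] (ha : ∀ i, 2 * r < |a i|)
    {F : Finset (Finset α)} (hF : ∀ A ∈ F, |c + ∑ i ∈ A, a i| ≤ r) :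
    F.card ≤ (Fintype.card α).choose (Fintype.card α / 2) := by
  classical
  -- Complementing on the indices of the negative steps makes all steps positive.
  obtain ⟨N, hN⟩ : ∃ N : Finset α, ∀ i, i ∈ N ↔ a i < 0 := ⟨Finset.univ.filter (a · < 0), by simp⟩
  rw [← Finset.card_image_of_injective F (symmDiff_left_injective N)]
  refine (isAntichain_of_abs_add_sum_le (c := c - ∑ i ∈ N, |a i|) ha ?_).sperner
  simp only [Finset.coe_image, Set.forall_mem_image]
  intro A hA
  rw [sub_add_eq_add_sub, add_sub_assoc, ← sum_eq_sum_symmDiff_abs_sub hN]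
  exact hF A hA

theorem card_le_choose_of_sdiff_eq [DecidableEq α] {T B : Finset α} (ha : ∀ i ∈ T, 2 * r < |a i|)
    {F : Finset (Finset α)} (hF : ∀ A ∈ F, |c + ∑ i ∈ A, a i| ≤ r) (hB : ∀ A ∈ F, A \ T = B) :
    F.card ≤ T.card.choose (T.card / 2) := by
  have hinj : Set.InjOn (fun A : Finset α => A.subtype (· ∈ T)) F := by
    intro A hA A' hA' h
    have hinter : A ∩ T = A' ∩ T := by
      simpa [Finset.subtype_map, Finset.filter_mem_eq_inter] using
        congrArg (Finset.map (Function.Embedding.subtype (· ∈ T))) h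
    rw [← Finset.sdiff_union_inter A T, ← Finset.sdiff_union_inter A' T, hB A hA, hB A' hA', hinter]
  have hsum (A : Finset α) (hA : A ∈ F) :
      c + ∑ i ∈ B, a i + ∑ i ∈ A.subtype (· ∈ T), a i = c + ∑ i ∈ A, a i := by
    rw [Finset.sum_subtype_eq_sum_filter, Finset.filter_mem_eq_inter, ← hB A hA, add_assoc,
      add_comm (∑ i ∈ A \ T, a i), Finset.sum_inter_add_sum_sdiff]
  rw [← Finset.card_image_of_injOn hinj, ← Fintype.card_coe T]
  refine card_le_choose_of_abs_add_sum_le (a := fun i : T => a i) (c := c + ∑ i ∈ B, a i)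
    (fun i => ha i i.2) ?_
  simp only [Finset.forall_mem_image]
  intro A hA
  rw [hsum A hA]
  exact hF A hA

theorem card_le_choose_mul_two_pow [Fintype α] {T : Finset α} (ha : ∀ i ∈ T, 2 * r < |a i|)
    {F : Finset (Finset α)} (hF : ∀ A ∈ F, |c + ∑ i ∈ A, a i| ≤ r) :
    F.card ≤ T.card.choose (T.card / 2) * 2 ^ (Fintype.card α - T.card) := by
  classical
  rw [← Finset.card_compl, ← Finset.card_powerset]
  refine Finset.card_le_mul_card_image_of_maps_to (f := fun A => A \ T) (fun A _ => ?_) _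
    fun B _ => ?_
  · rw [Finset.mem_powerset, Finset.sdiff_eq_inter_compl]
    exact Finset.inter_subset_right
  · exact card_le_choose_of_sdiff_eq ha (fun A hA => hF A (Finset.mem_of_mem_filter A hA))
      fun A hA => (Finset.mem_filter.1 hA).2

end LittlewoodOfford

theorem centralBinom_sq_mul_le (n : ℕ) : n.centralBinom ^ 2 * (2 * n + 1) ≤ 16 ^ n := by
  induction n with
  | zero => simp
  | succ n ih =>
    refine le_of_mul_le_mul_left (a := (n + 1) ^ 2) ?_ (by positivity)
    calc (n + 1) ^ 2 * ((n + 1).centralBinom ^ 2 * (2 * (n + 1) + 1))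
        = ((n + 1) * (n + 1).centralBinom) ^ 2 * (2 * n + 3) := by ring
      _ = n.centralBinom ^ 2 * (2 * n + 1) * (4 * ((2 * n + 1) * (2 * n + 3))) := by
          rw [Nat.succ_mul_centralBinom_succ]
          ring
      _ ≤ 16 ^ n * (4 * (4 * (n + 1) ^ 2)) := Nat.mul_le_mul ih (by nlinarith)
      _ = (n + 1) ^ 2 * 16 ^ (n + 1) := by ring

theorem choose_middle_sq_mul_le (n : ℕ) : n.choose (n / 2) ^ 2 * (n + 1) ≤ 4 ^ n := by
  obtain ⟨m, rfl | rfl⟩ := n.even_or_odd'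
  · have h := centralBinom_sq_mul_le m
    rw [Nat.centralBinom_eq_two_mul_choose, show 16 = 4 ^ 2 from rfl, ← pow_mul] at h
    rwa [Nat.mul_div_cancel_left m two_pos]
  · have h := centralBinom_sq_mul_le (m + 1)
    have hcentral : (m + 1).centralBinom = 2 * (2 * m + 1).choose m := by
      rw [Nat.centralBinom_eq_two_mul_choose, show 2 * (m + 1) = 2 * m + 1 + 1 by ring,
        Nat.choose_succ_succ', Nat.choose_symm_half]
      ring
    have hpow : 16 ^ (m + 1) = 4 * 4 ^ (2 * m + 1) := by
      rw [← pow_succ', show 16 = 4 ^ 2 from rfl, ← pow_mul]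
      congr 1
    rw [hcentral, hpow] at h
    rw [show (2 * m + 1) / 2 = m by lia]
    nlinarith [sq_nonneg ((2 * m + 1).choose m)]

theorem choose_middle_le (n : ℕ) : (n.choose (n / 2) : ℝ) ≤ 2 ^ n / √(n + 1) := by
  rw [le_div_iff₀ (by positivity)]
  refine le_of_sq_le_sq ?_ (by positivity)
  rw [mul_pow, Real.sq_sqrt (by positivity), ← pow_mul, mul_comm n 2, pow_mul,
    show (2 : ℝ) ^ 2 = 4 by norm_num]
  exact_mod_cast choose_middle_sq_mul_le n

theorem card_le_two_pow_mul_of_abs_add_sum_le {α : Type*} [Fintype α] {a : α → ℝ}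
    {c r : ℝ} {T : Finset α} (ha : ∀ i ∈ T, 2 * r < |a i|) {F : Finset (Finset α)}
    (hF : ∀ A ∈ F, |c + ∑ i ∈ A, a i| ≤ r) (k : ℕ) :
    (F.card : ℝ) ≤ 2 ^ Fintype.card α * (1 / √(k + 1) + 2 ^ k * (1 / 2) ^ T.card) := by
  rcases lt_or_ge T.card k with hk | hk
  · have htriv : (F.card : ℝ) ≤ 2 ^ Fintype.card α := by
      exact_mod_cast F.card_le_univ.trans_eq (Fintype.card_finset)
    have hone : (1 : ℝ) ≤ 2 ^ k * (1 / 2) ^ T.card := by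
      rw [one_div, inv_pow, ← div_eq_mul_inv, one_le_div (by positivity)]
      exact pow_le_pow_right₀ one_le_two hk.le
    refine htriv.trans (le_mul_of_one_le_right (by positivity) ?_)
    exact hone.trans (le_add_of_nonneg_left (by positivity))
  · have hpow : (2 : ℝ) ^ T.card * 2 ^ (Fintype.card α - T.card) = 2 ^ Fintype.card α := by
      rw [← pow_add, Nat.add_sub_cancel' T.card_le_univ]
    calc (F.card : ℝ) ≤ T.card.choose (T.card / 2) * 2 ^ (Fintype.card α - T.card) := by
          exact_mod_cast card_le_choose_mul_two_pow ha hF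
      _ ≤ 2 ^ T.card / √(T.card + 1) * 2 ^ (Fintype.card α - T.card) := by
          gcongr
          exact choose_middle_le T.card
      _ = 2 ^ Fintype.card α * (1 / √(T.card + 1)) := by
          rw [← hpow]
          ring
      _ ≤ 2 ^ Fintype.card α * (1 / √(k + 1) + 2 ^ k * (1 / 2) ^ T.card) := by
          gcongr
          exact le_add_of_le_of_nonneg (by gcongr) (by positivity)

section Symmetrization

variable {ι : Type*}

/-- The choice, from two copies of a random vector, of the second copy on `A` and the first copy
off `A`. -/
def mixCopies [DecidableEq ι] (A : Finset ι) (z : ι → ℝ × ℝ) (j : ι) : ℝ :=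
  if j ∈ A then (z j).2 else (z j).1

theorem dotProduct_mixCopies [Fintype ι] [DecidableEq ι] (v : ι → ℝ) (A : Finset ι)
    (z : ι → ℝ × ℝ) :
    v ⬝ᵥ mixCopies A z = ∑ j, v j * (z j).1 + ∑ j ∈ A, v j * ((z j).2 - (z j).1) := by
  rw [← Fintype.sum_ite_mem A, ← Finset.sum_add_distrib]
  refine Finset.sum_congr rfl fun j _ => ?_
  by_cases hj : j ∈ A <;> simp [mixCopies, hj, mul_sub]

/-- The discount `1 / 2` for a coordinate whose two copies are more than `r` apart. -/
noncomputable def farDiscount (r : ℝ) (w : ℝ × ℝ) : ℝ :=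
  if r < dist w.2 w.1 then 1 / 2 else 1

theorem measurable_farDiscount (r : ℝ) : Measurable (farDiscount r) :=
  Measurable.ite (measurableSet_lt measurable_const (by fun_prop)) measurable_const
    measurable_const

theorem farDiscount_nonneg (r : ℝ) (w : ℝ × ℝ) : 0 ≤ farDiscount r w := by
  unfold farDiscount
  split_ifs <;> norm_num

theorem integrable_farDiscount (r : ℝ) (ν : Measure (ℝ × ℝ)) [IsFiniteMeasure ν] :
    Integrable (farDiscount r) ν := by
  refine Integrable.of_bound (measurable_farDiscount r).aestronglyMeasurable 1 (ae_of_all _ ?_)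
  intro w
  unfold farDiscount
  split_ifs <;> norm_num

theorem integral_farDiscount_le {ν : Measure ℝ} [IsProbabilityMeasure ν] {p r : ℝ}
    (hν : ∀ x, ν.real (Metric.closedBall x r) ≤ p) :
    ∫ w, farDiscount r w ∂ν.prod ν ≤ (1 + p) / 2 := by
  have hsection (x : ℝ) : ∫ y, farDiscount r (x, y) ∂ν ≤ (1 + p) / 2 := by
    have hind (y : ℝ) : farDiscount r (x, y) =
        1 / 2 + (Metric.closedBall x r).indicator (fun _ => 1 / 2) y := by
      by_cases hy : y ∈ Metric.closedBall x r
      · rw [Set.indicator_of_mem hy, farDiscount, if_neg (not_lt.2 hy)]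
        norm_num
      · rw [Set.indicator_of_notMem hy, farDiscount, if_pos (not_le.1 hy), add_zero]
    simp_rw [hind]
    rw [integral_add (integrable_const _)
        ((integrable_const _).indicator Metric.isClosed_closedBall.measurableSet),
      integral_indicator_const _ Metric.isClosed_closedBall.measurableSet]
    simp only [integral_const, probReal_univ, smul_eq_mul]
    linarith [hν x]
  rw [integral_prod _ (integrable_farDiscount r _)]
  exact (integral_mono (integrable_farDiscount r _).integral_prod_left (integrable_const _)
    hsection).trans_eq (by simp)

theorem prod_farDiscount (S : Finset ι) (r : ℝ) (z : ι → ℝ × ℝ) :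
    ∏ j ∈ S, farDiscount r (z j) = (1 / 2) ^ (S.filter fun j => r < dist (z j).2 (z j).1).card := by
  simp_rw [farDiscount, Finset.prod_ite, Finset.prod_const_one, mul_one, Finset.prod_const]

variable [Fintype ι] (ν : ι → Measure ℝ) [∀ j, IsProbabilityMeasure (ν j)]

theorem measurePreserving_mixCopies [DecidableEq ι] (A : Finset ι) :
    MeasurePreserving (mixCopies A) (Measure.pi fun j => (ν j).prod (ν j)) (Measure.pi ν) := by
  refine measurePreserving_pi (fun j => (ν j).prod (ν j)) ν
    (f := fun j w => if j ∈ A then w.2 else w.1) fun j => ?_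
  by_cases hj : j ∈ A
  · simpa [hj] using measurePreserving_snd (μ := ν j) (ν := ν j)
  · simpa [hj] using measurePreserving_fst (μ := ν j) (ν := ν j)

open scoped Classical in
theorem two_pow_card_mul_measureReal_le [DecidableEq ι] {G : Set (ι → ℝ)} (hG : MeasurableSet G)
    {f : (ι → ℝ × ℝ) → ℝ} (hf : Integrable f (Measure.pi fun j => (ν j).prod (ν j)))
    (hGf : ∀ z, ((Finset.univ.filter fun A => mixCopies A z ∈ G).card : ℝ) ≤ f z) :
    2 ^ Fintype.card ι * (Measure.pi ν).real G ≤
      ∫ z, f z ∂Measure.pi fun j => (ν j).prod (ν j) := by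
  have hmeas (A : Finset ι) : MeasurableSet (mixCopies A ⁻¹' G) :=
    (measurePreserving_mixCopies ν A).measurable hG
  have hpreimage (A : Finset ι) : ∫ z, (mixCopies A ⁻¹' G).indicator (fun _ => (1 : ℝ)) z
      ∂(Measure.pi fun j => (ν j).prod (ν j)) = (Measure.pi ν).real G := by
    rw [integral_indicator_const _ (hmeas A), smul_eq_mul, mul_one,
      (measurePreserving_mixCopies ν A).measureReal_preimage hG.nullMeasurableSet]
  have hcard (z : ι → ℝ × ℝ) : ∑ A, (mixCopies A ⁻¹' G).indicator (fun _ => (1 : ℝ)) z =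
      (Finset.univ.filter fun A => mixCopies A z ∈ G).card := by
    simp [Set.indicator_apply]
  calc 2 ^ Fintype.card ι * (Measure.pi ν).real G
      = ∫ z, ∑ A, (mixCopies A ⁻¹' G).indicator (fun _ => (1 : ℝ)) z
          ∂(Measure.pi fun j => (ν j).prod (ν j)) := by
        rw [integral_finsetSum _ fun A _ => (integrable_const _).indicator (hmeas A)]
        simp [hpreimage]
    _ ≤ ∫ z, f z ∂Measure.pi fun j => (ν j).prod (ν j) := by
        refine integral_mono (integrable_finsetSum _ fun A _ =>
          (integrable_const _).indicator (hmeas A)) hf fun z => ?_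
        exact (hcard z).trans_le (hGf z)

theorem integrable_prod_farDiscount (S : Finset ι) (r : ℝ) :
    Integrable (fun z : ι → ℝ × ℝ => ∏ j ∈ S, farDiscount r (z j))
      (Measure.pi fun j => (ν j).prod (ν j)) := by
  classical
  simp_rw [← Fintype.prod_ite_mem S]
  refine Integrable.fintype_prod
    (f := fun j w => if j ∈ S then farDiscount r w else 1) fun j => ?_
  split_ifs
  exacts [integrable_farDiscount r _, integrable_const 1]

variable {ν}

theorem integral_prod_farDiscount_le {p r : ℝ}
    (hν : ∀ j x, (ν j).real (Metric.closedBall x r) ≤ p) (S : Finset ι) :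
    ∫ z, ∏ j ∈ S, farDiscount r (z j) ∂(Measure.pi fun j => (ν j).prod (ν j)) ≤
      ((1 + p) / 2) ^ S.card := by
  classical
  have hfactor (j : ι) : ∫ w, (if j ∈ S then farDiscount r w else 1) ∂(ν j).prod (ν j) =
      if j ∈ S then ∫ w, farDiscount r w ∂(ν j).prod (ν j) else 1 := by
    split_ifs <;> simp
  simp_rw [← Fintype.prod_ite_mem S]
  rw [integral_fintype_prod_eq_prod fun j w => if j ∈ S then farDiscount r w else 1]
  simp_rw [hfactor, Fintype.prod_ite_mem]
  calc ∏ j ∈ S, ∫ w, farDiscount r w ∂(ν j).prod (ν j) ≤ ∏ _j ∈ S, (1 + p) / 2 :=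
        Finset.prod_le_prod (fun j _ => integral_nonneg (farDiscount_nonneg r))
          fun j _ => integral_farDiscount_le (hν j)
    _ = ((1 + p) / 2) ^ S.card := Finset.prod_const _

theorem measureReal_abs_dotProduct_le {p r τ : ℝ} (hr : 0 ≤ r)
    (hν : ∀ j x, (ν j).real (Metric.closedBall x r) ≤ p) (hτ : 0 < τ) {v : ι → ℝ} {S : Finset ι}
    (hS : ∀ j ∈ S, τ ≤ |v j|) (k : ℕ) :
    (Measure.pi ν).real {x | |v ⬝ᵥ x| ≤ τ * r / 2} ≤
      1 / √(k + 1) + 2 ^ k * ((1 + p) / 2) ^ S.card := by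
  classical
  have hint := integrable_prod_farDiscount ν S r
  have hcount (z : ι → ℝ × ℝ) :
      ((Finset.univ.filter fun A => mixCopies A z ∈ {x | |v ⬝ᵥ x| ≤ τ * r / 2}).card : ℝ) ≤
        2 ^ Fintype.card ι * (1 / √(k + 1) + 2 ^ k * ∏ j ∈ S, farDiscount r (z j)) := by
    rw [prod_farDiscount]
    refine card_le_two_pow_mul_of_abs_add_sum_le (a := fun j => v j * ((z j).2 - (z j).1))
      (c := ∑ j, v j * (z j).1) (r := τ * r / 2) (fun j hj => ?_) (fun A hA => ?_) k
    · obtain ⟨hjS, hfar⟩ := Finset.mem_filter.1 hj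
      rw [abs_mul, mul_div_cancel₀ _ two_ne_zero]
      exact mul_lt_mul' (hS j hjS) hfar hr (hτ.trans_le (hS j hjS))
    · rw [← dotProduct_mixCopies]
      exact (Finset.mem_filter.1 hA).2
  have hG : MeasurableSet {x : ι → ℝ | |v ⬝ᵥ x| ≤ τ * r / 2} :=
    measurableSet_le (by fun_prop) measurable_const
  refine le_of_mul_le_mul_left ?_ (show (0 : ℝ) < 2 ^ Fintype.card ι by positivity)
  calc _ ≤ ∫ z, 2 ^ Fintype.card ι * (1 / √(k + 1) + 2 ^ k * ∏ j ∈ S, farDiscount r (z j))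
          ∂(Measure.pi fun j => (ν j).prod (ν j)) :=
        two_pow_card_mul_measureReal_le ν hG
          (((integrable_const _).add (hint.const_mul _)).const_mul _) hcount
    _ = 2 ^ Fintype.card ι * (1 / √(k + 1) + 2 ^ k *
          ∫ z, ∏ j ∈ S, farDiscount r (z j) ∂(Measure.pi fun j => (ν j).prod (ν j))) := by
        rw [integral_const_mul, integral_add (integrable_const _) (hint.const_mul _),
          integral_const_mul, integral_const, probReal_univ, one_smul]
    _ ≤ _ := by
        gcongr
        exact integral_prod_farDiscount_le hν S

end Symmetrization

section NearlyNormal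

variable {α ι κ : Type*}

/-- The matrices for which some nonzero test vector `w a` is nearly normal to all rows in `I`: its
product with each of them is at most `1 / √2` times its norm. -/
def nearlyNormal [Fintype ι] (w : α → ι → ℝ) (I : Finset κ) : Set (κ → ι → ℝ) :=
  {M | ∃ a, w a ≠ 0 ∧ ∀ i ∈ I, (w a ⬝ᵥ M i) ^ 2 ≤ (w a ⬝ᵥ w a) / 2}

variable [Fintype ι]

theorem nearlyNormal_eq_iUnion (w : α → ι → ℝ) (I : Finset κ) :
    nearlyNormal w I = ⋃ a, {M | w a ≠ 0 ∧ ∀ i ∈ I, (w a ⬝ᵥ M i) ^ 2 ≤ (w a ⬝ᵥ w a) / 2} := by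
  ext M
  simp [nearlyNormal]

theorem measurableSet_nearlyNormal [Countable α] (w : α → ι → ℝ) (I : Finset κ) :
    MeasurableSet (nearlyNormal w I) := by
  have hrow (a : α) : MeasurableSet
      {M : κ → ι → ℝ | ∀ i ∈ I, (w a ⬝ᵥ M i) ^ 2 ≤ (w a ⬝ᵥ w a) / 2} := by
    simp only [Set.ofPred_forall]
    exact I.measurableSet_biInter fun i _ => measurableSet_le (by fun_prop) measurable_const
  rw [nearlyNormal_eq_iUnion]
  exact .iUnion fun a => (MeasurableSet.const _).inter (hrow a)

theorem update_mem_nearlyNormal_iff [DecidableEq κ] {w : α → ι → ℝ} {I : Finset κ} {i : κ}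
    (hi : i ∉ I) (M : κ → ι → ℝ) (y : ι → ℝ) :
    Function.update M i y ∈ nearlyNormal w I ↔ M ∈ nearlyNormal w I := by
  refine exists_congr fun a => and_congr_right fun _ => forall₂_congr fun k hk => ?_
  rw [Function.update_of_ne (ne_of_mem_of_not_mem hk hi)]

open StandardLaw in
theorem measureReal_nearlyNormal_le [Fintype α] [Fintype κ] {K : ℝ}
    (ν : κ → ι → StandardLaw K) (w : α → ι → ℝ) (I : Finset κ) :
    (matrixLaw ν).real (nearlyNormal w I) ≤ Fintype.card α * concentrationRate K ^ I.card := by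
  have htest (a : α) : (matrixLaw ν).real
      {M | w a ≠ 0 ∧ ∀ i ∈ I, (w a ⬝ᵥ M i) ^ 2 ≤ (w a ⬝ᵥ w a) / 2} ≤
        concentrationRate K ^ I.card := by
    by_cases ha : w a = 0
    · simp [ha, (concentrationRate_pos K).le]
    have hpi : {M : κ → ι → ℝ | w a ≠ 0 ∧ ∀ i ∈ I, (w a ⬝ᵥ M i) ^ 2 ≤ (w a ⬝ᵥ w a) / 2} =
        Set.pi I fun _ => {x | (w a ⬝ᵥ x) ^ 2 ≤ (w a ⬝ᵥ w a) / 2} := by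
      ext M
      simp [ha, Set.mem_pi]
    rw [hpi, measureReal_def, Measure.pi_pi_finset, ENNReal.toReal_prod]
    exact (Finset.prod_le_prod (fun _ _ => ENNReal.toReal_nonneg) fun i _ =>
      measureReal_dotProduct_sq_le (ν i) ha).trans_eq (Finset.prod_const _)
  rw [nearlyNormal_eq_iUnion]
  calc _ ≤ ∑ a, (matrixLaw ν).real
        {M | w a ≠ 0 ∧ ∀ i ∈ I, (w a ⬝ᵥ M i) ^ 2 ≤ (w a ⬝ᵥ w a) / 2} :=
        measureReal_iUnion_fintype_le _
    _ ≤ ∑ _a : α, concentrationRate K ^ I.card := Finset.sum_le_sum fun a _ => htest a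
    _ = _ := by rw [Finset.sum_const, Finset.card_univ, nsmul_eq_mul]

theorem sq_dotProduct_le_of_sum_abs_sub_le {K : ℝ} (hK : 0 < K) {v w x : ι → ℝ}
    (hx : ∀ j, |x j| ≤ K) (hvx : v ⬝ᵥ x = 0) (hvw : ∑ j, |w j - v j| ≤ 1 / (2 * K))
    {j₀ : ι} (hw : w j₀ = 1) : (w ⬝ᵥ x) ^ 2 ≤ (w ⬝ᵥ w) / 2 := by
  have hdot : |w ⬝ᵥ x| ≤ 1 / 2 := by
    calc |w ⬝ᵥ x| = |∑ j, (w j - v j) * x j| := by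
          rw [← sub_zero (w ⬝ᵥ x), ← hvx, ← sub_dotProduct]
          rfl
      _ ≤ ∑ j, |w j - v j| * K :=
          (Finset.abs_sum_le_sum_abs _ _).trans <| Finset.sum_le_sum fun j _ =>
            (abs_mul _ _).trans_le (mul_le_mul_of_nonneg_left (hx j) (abs_nonneg _))
      _ ≤ 1 / (2 * K) * K := by
          rw [← Finset.sum_mul]
          gcongr
      _ = 1 / 2 := by field_simp
  have hnorm : 1 ≤ w ⬝ᵥ w := by
    calc (1 : ℝ) = w j₀ * w j₀ := by rw [hw, one_mul]
      _ ≤ w ⬝ᵥ w := Finset.single_le_sum (f := fun j => w j * w j)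
          (fun j _ => mul_self_nonneg _) (Finset.mem_univ j₀)
  nlinarith [sq_le_sq₀ (abs_nonneg _) (by norm_num) |>.2 hdot, sq_abs (w ⬝ᵥ x)]

end NearlyNormal

section GridVector

/-- The grid point `(a - N) / N` of `[-1, 1]`. -/
noncomputable def gridPoint (N : ℕ) (a : Fin (2 * N + 1)) : ℝ := ((a : ℕ) - N) / N

theorem exists_abs_gridPoint_sub_le {N : ℕ} (hN : 0 < N) {x : ℝ} (hx : |x| ≤ 1) :
    ∃ a : Fin (2 * N + 1), |gridPoint N a - x| ≤ 1 / N ∧ (x = 1 → gridPoint N a = 1) := by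
  have hN' : (0 : ℝ) < N := mod_cast hN
  obtain ⟨hx₁, hx₂⟩ := abs_le.1 hx
  have hfloor : ⌊N * (x + 1)⌋₊ ≤ 2 * N :=
    Nat.floor_le_of_le (by push_cast; nlinarith)
  refine ⟨⟨⌊N * (x + 1)⌋₊, by omega⟩, ?_, ?_⟩
  · have hle := Nat.floor_le (show 0 ≤ N * (x + 1) by nlinarith)
    have hlt := Nat.lt_floor_add_one (N * (x + 1))
    have hsub : gridPoint N ⟨⌊N * (x + 1)⌋₊, by omega⟩ - x =
        ((⌊N * (x + 1)⌋₊ : ℝ) - N * (x + 1)) / N := by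
      simp only [gridPoint]
      field_simp
      ring
    rw [hsub, abs_div, abs_of_pos hN']
    gcongr
    exact abs_le.2 ⟨by linarith, by linarith⟩
  · rintro rfl
    have htop : ⌊(N : ℝ) * (1 + 1)⌋₊ = 2 * N := by
      rw [show (N : ℝ) * (1 + 1) = ((2 * N : ℕ) : ℝ) by push_cast; ring, Nat.floor_natCast]
    simp only [gridPoint, htop]
    push_cast
    field_simp
    ring

variable {ι : Type*} [DecidableEq ι] {m N : ℕ}

/-- The vector with the grid points `gridPoint N (p k).2` at the coordinates `(p k).1`. The `p`
enumerate a net of the vectors in `[-1, 1]^ι` supported on at most `m` coordinates. -/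
noncomputable def gridVector (p : Fin m → ι × Fin (2 * N + 1)) : ι → ℝ :=
  ∑ k, Pi.single (p k).1 (gridPoint N (p k).2)

theorem exists_gridVector_eq [Nonempty ι] (S : Finset ι) (hS : S.card ≤ m)
    (a : ι → Fin (2 * N + 1)) :
    ∃ p : Fin m → ι × Fin (2 * N + 1),
      ∀ j, gridVector p j = if j ∈ S then gridPoint N (a j) else 0 := by
  obtain ⟨e⟩ : Nonempty (S ↪ Fin m) :=
    Function.Embedding.nonempty_of_card_le (by simpa using hS)
  let p : Fin m → ι × Fin (2 * N + 1) := Function.extend e (fun s => (s, a s))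
    fun _ => (Classical.arbitrary ι, ⟨N, by omega⟩)
  have hsum (j : ι) : gridVector p j =
      ∑ s : S, (Pi.single (s : ι) (gridPoint N (a s)) : ι → ℝ) j := by
    rw [gridVector, Finset.sum_apply]
    refine (Fintype.sum_of_injective e e.injective _ _ (fun k hk => ?_) fun s => ?_).symm
    · simp [p, gridPoint, Function.extend_apply' _ _ _ (show ¬∃ s, e s = k from hk)]
    · simp [p, e.injective.extend_apply]
  refine ⟨p, fun j => ?_⟩
  simp_rw [hsum, Pi.single_apply]
  rw [Finset.sum_coe_sort S (fun s => if j = s then gridPoint N (a s) else 0), Finset.sum_ite_eq]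

theorem exists_gridVector_sum_abs_sub_le [Fintype ι] (hN : 0 < N) (S : Finset ι)
    (hS : S.card ≤ m) {v : ι → ℝ} (hv : ∀ j, |v j| ≤ 1) {j₀ : ι} (hj₀ : j₀ ∈ S) (hv₀ : v j₀ = 1) :
    ∃ p : Fin m → ι × Fin (2 * N + 1), gridVector p j₀ = 1 ∧
      ∑ j, |gridVector p j - v j| ≤ m / N + ∑ j with j ∉ S, |v j| := by
  choose a ha ha₁ using fun j => exists_abs_gridPoint_sub_le hN (hv j)
  have : Nonempty ι := ⟨j₀⟩
  obtain ⟨p, hp⟩ := exists_gridVector_eq S hS a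
  refine ⟨p, by rw [hp, if_pos hj₀, ha₁ j₀ hv₀], ?_⟩
  have hoff : ∑ j with j ∉ S, |gridVector p j - v j| = ∑ j with j ∉ S, |v j| := by
    refine Finset.sum_congr rfl fun j hj => ?_
    rw [hp, if_neg (Finset.mem_filter.1 hj).2, zero_sub, abs_neg]
  have hon : ∑ j with j ∈ S, |gridVector p j - v j| ≤ m / N := by
    rw [Finset.filter_univ_mem]
    calc ∑ j ∈ S, |gridVector p j - v j| ≤ ∑ _j ∈ S, (1 / N : ℝ) :=
          Finset.sum_le_sum fun j hj => by simpa [hp, hj] using ha j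
      _ = S.card / N := by rw [Finset.sum_const, nsmul_eq_mul, mul_one_div]
      _ ≤ m / N := by gcongr
  rw [← Finset.sum_filter_add_sum_filter_not Finset.univ (· ∈ S), hoff]
  exact add_le_add_left hon _

theorem lt_card_large_of_notMem_nearlyNormal [Fintype ι] {κ : Type*} {K : ℝ} (hK : 1 ≤ K)
    (hN₀ : 0 < N) (hN : 4 * K * m ≤ N) {I : Finset κ} {M : κ → ι → ℝ}
    (hM : M ∉ nearlyNormal (gridVector (m := m) (N := N)) I)
    (hbound : ∀ i ∈ I, ∀ j, |M i j| ≤ K) {v : ι → ℝ} (hv : ∀ j, |v j| ≤ 1) {j₀ : ι}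
    (hv₀ : v j₀ = 1) (hnormal : ∀ i ∈ I, v ⬝ᵥ M i = 0) :
    m < (Finset.univ.filter fun j => 1 / (4 * K * Fintype.card ι) ≤ |v j|).card := by
  by_contra! hS
  set S := Finset.univ.filter fun j => 1 / (4 * K * Fintype.card ι) ≤ |v j|
  have hcard : (1 : ℝ) ≤ Fintype.card ι := mod_cast Fintype.card_pos_iff.2 ⟨j₀⟩
  have hj₀ : j₀ ∈ S := by
    refine Finset.mem_filter.2 ⟨Finset.mem_univ _, ?_⟩
    rw [hv₀, abs_one, div_le_one (by positivity)]
    nlinarith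
  obtain ⟨p, hp₀, hp⟩ := exists_gridVector_sum_abs_sub_le hN₀ S hS hv hj₀ hv₀
  have hgrid : (m : ℝ) / N ≤ 1 / (4 * K) := by
    rw [div_le_div_iff₀ (by positivity) (by positivity)]
    linarith
  have hsmall : ∑ j with j ∉ S, |v j| ≤ 1 / (4 * K) := by
    calc ∑ j with j ∉ S, |v j| ≤ ∑ j with j ∉ S, 1 / (4 * K * Fintype.card ι) :=
          Finset.sum_le_sum fun j hj => by
            have := (Finset.mem_filter.1 hj).2
            simp only [S, Finset.mem_filter_univ, not_le] at this
            exact this.le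
      _ ≤ ∑ _j : ι, 1 / (4 * K * Fintype.card ι) :=
          Finset.sum_le_univ_sum_of_nonneg fun _ => by positivity
      _ = 1 / (4 * K) := by
          rw [Finset.sum_const, Finset.card_univ, nsmul_eq_mul]
          field_simp
  have hclose : ∑ j, |gridVector p j - v j| ≤ 1 / (2 * K) := by
    calc _ ≤ 1 / (4 * K) + 1 / (4 * K) := hp.trans (add_le_add hgrid hsmall)
      _ = 1 / (2 * K) := by field_simp; norm_num
  refine hM ⟨p, fun h => by simp [h] at hp₀, fun i hi => ?_⟩
  exact sq_dotProduct_le_of_sum_abs_sub_le (by linarith) (hbound i hi) (hnormal i hi) hclose hp₀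

end GridVector

section GramSchmidt

open InnerProductSpace

theorem real_inner_starProjection_self {E : Type*} [NormedAddCommGroup E] [InnerProductSpace ℝ E]
    (V : Submodule ℝ E) [V.HasOrthogonalProjection] (x : E) :
    inner ℝ (V.starProjection x) x = ‖V.starProjection x‖ ^ 2 := by
  have hmem := V.starProjection_apply_mem x
  rw [← real_inner_self_eq_norm_sq, V.inner_starProjection_left_eq_right,
    V.inner_starProjection_left_eq_right, Submodule.starProjection_eq_self_iff.2 hmem]

variable {κ : Type*} [LinearOrder κ] [LocallyFiniteOrderBot κ] [WellFoundedLT κ]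

theorem gramSchmidt_eq_starProjection {𝕜 E : Type*} [RCLike 𝕜] [NormedAddCommGroup E]
    [InnerProductSpace 𝕜 E] [FiniteDimensional 𝕜 E] (f : κ → E) (i : κ) :
    gramSchmidt 𝕜 f i = (Submodule.span 𝕜 (f '' Set.Iio i))ᗮ.starProjection (f i) := by
  rw [← span_gramSchmidt_Iio]
  refine (Submodule.eq_starProjection_of_mem_orthogonal
    (K := (Submodule.span 𝕜 (gramSchmidt 𝕜 f '' Set.Iio i))ᗮ) ?_ ?_).symm
  · refine Submodule.isOrtho_span.2 ?_ (Submodule.mem_span_singleton_self (gramSchmidt 𝕜 f i))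
    rintro _ rfl _ ⟨k, hk, rfl⟩
    exact gramSchmidt_orthogonal 𝕜 f (ne_of_gt hk)
  · rw [Submodule.orthogonal_orthogonal, gramSchmidt_def, sub_sub_cancel]
    refine Submodule.sum_mem _ fun k hk => ?_
    refine Submodule.span_mono (Set.singleton_subset_iff.2 ?_)
      (Submodule.starProjection_apply_mem _ _)
    exact Set.mem_image_of_mem _ (Finset.mem_Iio.1 hk)

theorem measurable_gramSchmidt {E : Type*} [NormedAddCommGroup E] [InnerProductSpace ℝ E]
    [MeasurableSpace E] [BorelSpace E] [SecondCountableTopology E] (i : κ) :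
    Measurable fun f : κ → E => gramSchmidt ℝ f i := by
  induction i using WellFoundedLT.induction with
  | _ i ih =>
    have hdef (f : κ → E) : gramSchmidt ℝ f i = f i - ∑ k ∈ Finset.Iio i,
        (inner ℝ (gramSchmidt ℝ f k) (f i) / ‖gramSchmidt ℝ f k‖ ^ 2) • gramSchmidt ℝ f k :=
      eq_sub_of_add_eq (gramSchmidt_def'' ℝ f i).symm
    simp_rw [hdef]
    refine (measurable_pi_apply i).sub (Finset.measurable_sum _ fun k hk => ?_)
    have hk := ih k (Finset.mem_Iio.1 hk)
    exact ((hk.inner (measurable_pi_apply i)).div (hk.norm.pow_const 2)).smul hk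

theorem abs_det_toBasis_eq_prod_norm_gramSchmidt {E : Type*} [NormedAddCommGroup E]
    [InnerProductSpace ℝ E] [Fintype κ] (e : OrthonormalBasis κ ℝ E) (f : κ → E) :
    |e.toBasis.det f| = ∏ i, ‖gramSchmidt ℝ f i‖ := by
  have : FiniteDimensional ℝ E := e.toBasis.finiteDimensional_of_finite
  have hrank := Module.finrank_eq_card_basis e.toBasis
  set b := gramSchmidtOrthonormalBasis hrank f
  have hinner (i : κ) : inner ℝ (b i) (f i) = ‖gramSchmidt ℝ f i‖ := by
    by_cases hi : gramSchmidtNormed ℝ f i = 0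
    · rw [inner_gramSchmidtOrthonormalBasis_eq_zero hrank hi]
      rw [gramSchmidtNormed] at hi
      simpa [eq_comm] using hi
    have hself : inner ℝ (gramSchmidt ℝ f i) (f i) = ‖gramSchmidt ℝ f i‖ ^ 2 := by
      rw [gramSchmidt_eq_starProjection, real_inner_starProjection_self]
    rw [gramSchmidtOrthonormalBasis_apply hrank hi, gramSchmidtNormed, real_inner_smul_left, hself,
      sq]
    have hne : gramSchmidt ℝ f i ≠ 0 := fun h => hi (by rw [gramSchmidtNormed, h, smul_zero])
    exact inv_mul_cancel_left₀ (norm_ne_zero_iff.2 hne) _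
  have hbase : |e.toBasis.det b| = 1 := e.det_to_matrix_orthonormalBasis b
  rw [e.toBasis.det.eq_smul_basis_det b.toBasis, AlternatingMap.smul_apply, smul_eq_mul, abs_mul,
    b.coe_toBasis, hbase, one_mul, gramSchmidtOrthonormalBasis_det, Finset.abs_prod]
  exact Finset.prod_congr rfl fun i _ => by rw [hinner, abs_norm]

end GramSchmidt

section RowHeight

variable {ι κ : Type*} [Fintype ι]

theorem exists_matrix_dotProduct_eq_norm_starProjection_sq
    (V : Submodule ℝ (EuclideanSpace ℝ ι)) :
    ∃ P : Matrix ι ι ℝ, P.trace = Module.finrank ℝ V ∧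
      ∑ i, ∑ j, P i j ^ 2 = (Module.finrank ℝ V : ℝ) ∧
      ∀ x, x ⬝ᵥ P *ᵥ x = ‖V.starProjection (WithLp.toLp 2 x)‖ ^ 2 := by
  classical
  let toCLM := Matrix.toEuclideanCLM (n := ι) (𝕜 := ℝ)
  set P := toCLM.symm V.starProjection
  have hP : toCLM P = V.starProjection := toCLM.apply_symm_apply _
  have hproj : IsStarProjection P := by
    obtain ⟨hidem, hself⟩ := isStarProjection_starProjection (U := V)
    refine ⟨EquivLike.injective toCLM ?_, EquivLike.injective toCLM ?_⟩
    · rw [map_mul, hP, hidem.eq]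
    · rw [map_star, hP, hself.star_eq]
  have hform (x : ι → ℝ) : x ⬝ᵥ P *ᵥ x = ‖V.starProjection (WithLp.toLp 2 x)‖ ^ 2 := by
    rw [← real_inner_starProjection_self, ← hP, real_inner_comm]
    exact (Matrix.inner_toEuclideanCLM P (WithLp.toLp 2 x) (WithLp.toLp 2 x)).symm
  have htrace : P.trace = Module.finrank ℝ V := by
    have hisProj : LinearMap.IsProj V V.starProjection.toLinearMap :=
      ⟨V.starProjection_apply_mem, fun x hx => Submodule.starProjection_eq_self_iff.2 hx⟩
    rw [← hisProj.trace, LinearMap.trace_eq_sum_inner _ (EuclideanSpace.basisFun ι ℝ), ← hP]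
    refine Finset.sum_congr rfl fun i _ => ?_
    change P i i = inner ℝ _ (toCLM P _)
    simp [toCLM, Matrix.inner_toEuclideanCLM]
  refine ⟨P, htrace, ?_, hform⟩
  rw [← htrace, Matrix.trace, Finset.sum_congr rfl fun i _ => ?_]
  have hsymm (j : ι) : P j i = P i j := congrFun₂ hproj.isSelfAdjoint.star_eq i j
  conv_rhs => rw [Matrix.diag_apply, ← hproj.isIdempotentElem.eq, Matrix.mul_apply]
  simp_rw [hsymm, sq]

/-- Row `k` of `M` as a vector of Euclidean space. -/
def euclideanRow (M : κ → ι → ℝ) (k : κ) : EuclideanSpace ℝ ι := WithLp.toLp 2 (M k)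

/-- The vectors orthogonal to the rows of `M` preceding row `i`. -/
noncomputable def normalSpace [Preorder κ] (M : κ → ι → ℝ) (i : κ) :
    Submodule ℝ (EuclideanSpace ℝ ι) :=
  (Submodule.span ℝ (euclideanRow M '' Set.Iio i))ᗮ

variable [LinearOrder κ]

theorem dotProduct_eq_zero_of_mem_normalSpace {M : κ → ι → ℝ} {i k : κ} (hk : k < i)
    {v : EuclideanSpace ℝ ι} (hv : v ∈ normalSpace M i) : v ⬝ᵥ M k = 0 := by
  have hmem : euclideanRow M k ∈ Submodule.span ℝ (euclideanRow M '' Set.Iio i) :=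
    Submodule.subset_span (Set.mem_image_of_mem _ hk)
  exact Submodule.inner_right_of_mem_orthogonal hmem hv

theorem normalSpace_update (M : κ → ι → ℝ) (i : κ) (y : ι → ℝ) :
    normalSpace (Function.update M i y) i = normalSpace M i := by
  rw [normalSpace, Set.image_congr fun k hk => ?_, normalSpace]
  rw [euclideanRow, Function.update_of_ne (ne_of_lt hk), euclideanRow]

variable [LocallyFiniteOrderBot κ]

theorem card_sub_card_Iio_le_finrank_normalSpace (M : κ → ι → ℝ) (i : κ) :
    Fintype.card ι - (Finset.Iio i).card ≤ Module.finrank ℝ (normalSpace M i) := by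
  classical
  have hsum := (Submodule.span ℝ (euclideanRow M '' Set.Iio i)).finrank_add_finrank_orthogonal
  have hspan : Module.finrank ℝ (Submodule.span ℝ (euclideanRow M '' Set.Iio i)) ≤
      (Finset.Iio i).card := by
    rw [← Finset.coe_Iio, ← Finset.coe_image]
    exact (finrank_span_finset_le_card _).trans Finset.card_image_le
  rw [finrank_euclideanSpace] at hsum
  unfold normalSpace
  omega

variable [WellFoundedLT κ]

/-- The distance of row `i` of `M` from the span of the preceding rows, as the length of the `i`-th
vector of the Gram-Schmidt process. -/
noncomputable def rowHeight (M : κ → ι → ℝ) (i : κ) : ℝ :=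
  ‖InnerProductSpace.gramSchmidt ℝ (euclideanRow M) i‖

theorem rowHeight_nonneg (M : κ → ι → ℝ) (i : κ) : 0 ≤ rowHeight M i :=
  norm_nonneg _

theorem measurable_rowHeight (i : κ) : Measurable fun M : κ → ι → ℝ => rowHeight M i :=
  ((measurable_gramSchmidt i).comp (measurable_pi_lambda _ fun k =>
    (WithLp.measurable_toLp 2 _).comp (measurable_pi_apply k))).norm

theorem rowHeight_eq_norm_starProjection (M : κ → ι → ℝ) (i : κ) :
    rowHeight M i = ‖(normalSpace M i).starProjection (euclideanRow M i)‖ := by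
  rw [rowHeight, gramSchmidt_eq_starProjection, normalSpace]

theorem exists_matrix_rowHeight_update_sq_eq (M : κ → ι → ℝ) (i : κ) :
    ∃ P : Matrix ι ι ℝ, P.trace = Module.finrank ℝ (normalSpace M i) ∧
      ∑ j, ∑ l, P j l ^ 2 = (Module.finrank ℝ (normalSpace M i) : ℝ) ∧
      ∀ y, rowHeight (Function.update M i y) i ^ 2 = y ⬝ᵥ P *ᵥ y := by
  obtain ⟨P, htrace, hfrobenius, hform⟩ :=
    exists_matrix_dotProduct_eq_norm_starProjection_sq (normalSpace M i)
  refine ⟨P, htrace, hfrobenius, fun y => ?_⟩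
  rw [hform, rowHeight_eq_norm_starProjection, normalSpace_update, euclideanRow,
    Function.update_self]

theorem norm_le_sqrt_card_mul_norm_ofLp (v : EuclideanSpace ℝ ι) :
    ‖v‖ ≤ √(Fintype.card ι) * ‖v.ofLp‖ := by
  have hsum : ∑ j, ‖v j‖ ^ 2 ≤ Fintype.card ι * ‖v.ofLp‖ ^ 2 := by
    rw [← nsmul_eq_mul]
    exact Finset.sum_le_card_nsmul _ _ _ fun j _ => by gcongr; exact norm_le_pi_norm v.ofLp j
  rw [EuclideanSpace.norm_eq, ← Real.sqrt_sq (norm_nonneg v.ofLp),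
    ← Real.sqrt_mul (Nat.cast_nonneg _)]
  exact Real.sqrt_le_sqrt hsum

theorem abs_dotProduct_le_mul_rowHeight {M : κ → ι → ℝ} {i : κ} {v : EuclideanSpace ℝ ι}
    (hv : v ∈ normalSpace M i) :
    |v ⬝ᵥ M i| ≤ √(Fintype.card ι) * ‖v.ofLp‖ * rowHeight M i := by
  have hinner : v ⬝ᵥ M i = inner ℝ v ((normalSpace M i).starProjection (euclideanRow M i)) := by
    rw [← Submodule.inner_starProjection_left_eq_right,
      Submodule.starProjection_eq_self_iff.2 hv, EuclideanSpace.inner_eq_star_dotProduct,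
      dotProduct_comm]
    rfl
  rw [hinner, rowHeight_eq_norm_starProjection]
  exact (abs_real_inner_le_norm _ _).trans (by gcongr; exact norm_le_sqrt_card_mul_norm_ofLp v)

theorem exists_submodule_abs_dotProduct_le_mul_rowHeight (M : κ → ι → ℝ) (i : κ) :
    ∃ V : Submodule ℝ (ι → ℝ), Fintype.card ι - (Finset.Iio i).card ≤ Module.finrank ℝ V ∧
      (∀ v ∈ V, ∀ k < i, v ⬝ᵥ M k = 0) ∧ ∀ v ∈ V, ∀ y,
        |v ⬝ᵥ y| ≤ √(Fintype.card ι) * ‖v‖ * rowHeight (Function.update M i y) i := by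
  let e := WithLp.linearEquiv 2 ℝ (ι → ℝ)
  refine ⟨(normalSpace M i).map e.toLinearMap, ?_, ?_, ?_⟩
  · rw [LinearEquiv.finrank_map_eq e]
    exact card_sub_card_Iio_le_finrank_normalSpace M i
  · rintro _ ⟨v, hv, rfl⟩ k hk
    exact dotProduct_eq_zero_of_mem_normalSpace hk hv
  · rintro _ ⟨v, hv, rfl⟩ y
    rw [SetLike.mem_coe, ← normalSpace_update M i y] at hv
    have hle := abs_dotProduct_le_mul_rowHeight hv
    rw [Function.update_self] at hle
    exact hle

theorem abs_det_eq_prod_rowHeight [Fintype κ] (M : κ → κ → ℝ) :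
    |(Matrix.of M).det| = ∏ i, rowHeight M i := by
  rw [← Matrix.det_transpose]
  exact abs_det_toBasis_eq_prod_norm_gramSchmidt (EuclideanSpace.basisFun κ ℝ) (euclideanRow M)

end RowHeight

section RowBounds

open StandardLaw

variable {n : ℕ} {K : ℝ}

/-- The relative amount by which the squared height of row `i` falls short of `n - i`, its expected
value in general position. It is negative when the row is higher than that. -/
noncomputable def rowDeficiency (M : Fin n → Fin n → ℝ) (i : Fin n) : ℝ :=
  1 - rowHeight M i ^ 2 / (n - i : ℕ)

theorem measurable_rowDeficiency (i : Fin n) : Measurable fun M => rowDeficiency M i :=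
  (((measurable_rowHeight i).pow_const 2).div_const _).const_sub 1

theorem lintegral_rowDeficiency_le (ν : Fin n → Fin n → StandardLaw K) (i : Fin n) :
    ∫⁻ M, ENNReal.ofReal (rowDeficiency M i) ∂matrixLaw ν ≤
      ENNReal.ofReal (√2 * |K| / √(n - i : ℕ)) := by
  have hpos : (0 : ℝ) < (n - i : ℕ) := mod_cast Nat.sub_pos_of_lt i.2
  refine lintegral_pi_le_of_update _ (measurable_rowDeficiency i).ennreal_ofReal i fun M => ?_
  obtain ⟨P, htrace, hfrobenius, hform⟩ := exists_matrix_rowHeight_update_sq_eq M i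
  have hrank : ((n - i : ℕ) : ℝ) ≤ Module.finrank ℝ (normalSpace M i) := by
    have := card_sub_card_Iio_le_finrank_normalSpace M i
    rw [Fintype.card_fin, Fin.card_Iio] at this
    exact_mod_cast this
  calc ∫⁻ y, ENNReal.ofReal (rowDeficiency (Function.update M i y) i) ∂vectorLaw (ν i)
      ≤ ∫⁻ y, ENNReal.ofReal (1 - (y ⬝ᵥ P *ᵥ y) / Module.finrank ℝ (normalSpace M i))
          ∂vectorLaw (ν i) := by
        gcongr with y
        rw [rowDeficiency, ← hform y]
        gcongr
    _ ≤ ENNReal.ofReal (√2 * |K| / √(Module.finrank ℝ (normalSpace M i))) :=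
        lintegral_one_sub_dotProduct_mulVec_div_le _ _ (hpos.trans_le hrank) htrace hfrobenius
    _ ≤ ENNReal.ofReal (√2 * |K| / √(n - i : ℕ)) := by gcongr

theorem measureReal_rowHeight_lt_le_pow (ν : Fin n → Fin n → StandardLaw K) (i : Fin n) :
    (matrixLaw ν).real {M | rowHeight M i < 1 / (2 * √n)} ≤ concentrationRate K ^ (n - i : ℕ) := by
  have hn : 0 < √(n : ℝ) := Real.sqrt_pos.2 (mod_cast i.pos)
  have hrow := measureReal_pi_inter_le_mul (fun k => vectorLaw (ν k)) MeasurableSet.univ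
    (measurableSet_lt (measurable_rowHeight i) (measurable_const (a := 1 / (2 * √n)))) i
    (fun _ _ => Iff.rfl) (pow_nonneg (concentrationRate_pos K).le (n - i)) fun M _ => ?_
  · simpa using hrow
  obtain ⟨V, hrank, -, hV⟩ := exists_submodule_abs_dotProduct_le_mul_rowHeight M i
  rw [Fintype.card_fin, Fin.card_Iio] at hrank
  refine (measureReal_mono fun y hy v hv => ?_).trans (measureReal_forall_mem_abs_dotProduct_le
    one_half_pos.le (fun j => (ν i j).measureReal_closedBall_le) hrank)
  calc |v ⬝ᵥ y| ≤ √n * ‖v‖ * rowHeight (Function.update M i y) i := by simpa using hV v hv y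
    _ ≤ √n * ‖v‖ * (1 / (2 * √n)) := by gcongr; exact le_of_lt hy
    _ = 1 / 2 * ‖v‖ := by field_simp

/-- The matrices whose rows in `I` are bounded by `K` and are not nearly normal to any vector of the
net of `m`-sparse vectors with mesh `1 / N`. -/
def regularRows (K : ℝ) (m N : ℕ) (I : Finset (Fin n)) : Set (Fin n → Fin n → ℝ) :=
  (nearlyNormal (gridVector (m := m) (N := N)) I)ᶜ ∩ {M | ∀ i ∈ I, ∀ j, |M i j| ≤ K}

variable {m N : ℕ} {I : Finset (Fin n)}

theorem measurableSet_regularRows : MeasurableSet (regularRows K m N I) := by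
  refine (measurableSet_nearlyNormal _ I).compl.inter ?_
  simp only [Set.ofPred_forall]
  exact I.measurableSet_biInter fun i _ => .iInter fun j =>
    measurableSet_le (by fun_prop) measurable_const

theorem update_mem_regularRows_iff {i : Fin n} (hi : i ∉ I) (M : Fin n → Fin n → ℝ)
    (y : Fin n → ℝ) : Function.update M i y ∈ regularRows K m N I ↔ M ∈ regularRows K m N I := by
  refine and_congr (not_congr (update_mem_nearlyNormal_iff hi M y)) (forall₂_congr fun k hk => ?_)
  rw [Function.update_of_ne (ne_of_mem_of_not_mem hk hi)]

theorem ae_forall_abs_le (ν : Fin n → Fin n → StandardLaw K) :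
    ∀ᵐ M ∂matrixLaw ν, ∀ i j, |M i j| ≤ K := by
  refine ae_all_iff.2 fun i => ae_all_iff.2 fun j => ?_
  have hentry : ∀ᵐ x ∂vectorLaw (ν i), |x j| ≤ K :=
    (measurePreserving_eval (fun j => (ν i j).toMeasure) j).quasiMeasurePreserving.ae
      (ν i j).ae_abs_le
  exact (measurePreserving_eval (fun i => vectorLaw (ν i)) i).quasiMeasurePreserving.ae hentry

theorem measureReal_compl_regularRows_le (ν : Fin n → Fin n → StandardLaw K) :
    (matrixLaw ν).real (regularRows K m N I)ᶜ ≤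
      (n * (2 * N + 1)) ^ m * concentrationRate K ^ I.card := by
  have hae : ∀ᵐ M ∂matrixLaw ν, M ∈ (regularRows K m N I)ᶜ ↔
      M ∈ nearlyNormal (gridVector (m := m) (N := N)) I := by
    filter_upwards [ae_forall_abs_le ν] with M hM
    simp [regularRows, hM]
  rw [measureReal_congr (eventuallyEq_set.2 hae)]
  simpa using measureReal_nearlyNormal_le ν (gridVector (m := m) (N := N)) I

variable (ν : Fin n → Fin n → StandardLaw K)

theorem measureReal_regularRows_inter_rowHeight_lt_le (hN₀ : 0 < N) (hN : 4 * K * m ≤ N)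
    {i : Fin n} (hI : ∀ k ∈ I, k < i) (k : ℕ) :
    (matrixLaw ν).real (regularRows K m N I ∩ {M | rowHeight M i < 1 / (16 * K * n * √n)}) ≤
      1 / √(k + 1) + 2 ^ k * ((1 + concentrationRate K) / 2) ^ m := by
  have hK := (ν i i).one_le_bound
  have hn : (0 : ℝ) < n := mod_cast i.pos
  have hρ := concentrationRate_pos K
  have hρ₁ := concentrationRate_lt_one K
  have hbound : 0 ≤ 1 / √((k : ℝ) + 1) + 2 ^ k * ((1 + concentrationRate K) / 2) ^ m := by
    positivity
  refine (measureReal_pi_inter_le_mul (fun k => vectorLaw (ν k)) measurableSet_regularRows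
    (measurableSet_lt (measurable_rowHeight i) measurable_const) i
    (update_mem_regularRows_iff fun hi => (hI i hi).false) hbound fun M hM => ?_).trans
    (mul_le_of_le_one_right hbound measureReal_le_one)
  obtain ⟨V, hrank, hnormal, hV⟩ := exists_submodule_abs_dotProduct_le_mul_rowHeight M i
  have hV₀ : V ≠ ⊥ := by
    rintro rfl
    rw [Fintype.card_fin, Fin.card_Iio, finrank_bot] at hrank
    omega
  obtain ⟨v, hv, j, hvj, hvnorm⟩ := exists_mem_apply_eq_one_norm_le_one hV₀
  have hlarge := lt_card_large_of_notMem_nearlyNormal hK hN₀ hN hM.1 hM.2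
    (fun j => (norm_le_pi_norm v j).trans hvnorm) hvj fun k hk => hnormal v hv k (hI k hk)
  rw [Fintype.card_fin] at hlarge
  set S := Finset.univ.filter fun j => 1 / (4 * K * n) ≤ |v j|
  calc (vectorLaw (ν i)).real {y | rowHeight (Function.update M i y) i < 1 / (16 * K * n * √n)}
      ≤ (vectorLaw (ν i)).real {y | |v ⬝ᵥ y| ≤ 1 / (4 * K * n) * (1 / 2) / 2} := by
        refine measureReal_mono fun y hy => ?_
        calc |v ⬝ᵥ y| ≤ √n * ‖v‖ * rowHeight (Function.update M i y) i := by
              simpa using hV v hv y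
          _ ≤ √n * 1 * (1 / (16 * K * n * √n)) := by
              gcongr
              · exact rowHeight_nonneg _ _
              · exact le_of_lt hy
          _ = 1 / (4 * K * n) * (1 / 2) / 2 := by field_simp; norm_num
    _ ≤ 1 / √(k + 1) + 2 ^ k * ((1 + concentrationRate K) / 2) ^ S.card :=
        measureReal_abs_dotProduct_le one_half_pos.le
          (fun j => (ν i j).measureReal_closedBall_le) (by positivity)
          (fun j hj => (Finset.mem_filter.1 hj).2) k
    _ ≤ 1 / √(k + 1) + 2 ^ k * ((1 + concentrationRate K) / 2) ^ m := by
        gcongr 1 / √(k + 1) + 2 ^ k * ?_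
        exact pow_le_pow_of_le_one (by positivity) (by linarith) hlarge.le

theorem sum_pow_le_of_injOn {α : Type*} {p : ℝ} (hp₀ : 0 ≤ p) (hp₁ : p < 1) {s : Finset α}
    {f : α → ℕ} (hf : Set.InjOn f s) {L : ℕ} (hL : ∀ a ∈ s, L ≤ f a) :
    ∑ a ∈ s, p ^ f a ≤ p ^ L / (1 - p) := by
  have hinj : Set.InjOn (fun a => f a - L) s := fun a ha b hb hab =>
    hf ha hb ((tsub_left_inj (hL a ha) (hL b hb)).1 hab)
  calc ∑ a ∈ s, p ^ f a = p ^ L * ∑ a ∈ s, p ^ (f a - L) := by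
        rw [Finset.mul_sum]
        exact Finset.sum_congr rfl fun a ha => by rw [← pow_add, Nat.add_sub_cancel' (hL a ha)]
    _ = p ^ L * ∑ k ∈ s.image fun a => f a - L, p ^ k := by rw [Finset.sum_image hinj]
    _ ≤ p ^ L * (1 - p)⁻¹ := by
        rw [← tsum_geometric_of_lt_one hp₀ hp₁]
        gcongr
        exact (summable_geometric_of_lt_one hp₀ hp₁).sum_le_tsum _ fun _ _ => pow_nonneg hp₀ _
    _ = p ^ L / (1 - p) := (div_eq_mul_inv _ _).symm

theorem measureReal_exists_early_rowHeight_lt_le {L : ℕ} (hL : ∀ i ∈ I, L ≤ n - i) :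
    (matrixLaw ν).real (⋃ i ∈ I, {M | rowHeight M i < 1 / (16 * K * n * √n)}) ≤
      concentrationRate K ^ L / (1 - concentrationRate K) := by
  have hinj : Set.InjOn (fun i : Fin n => n - (i : ℕ)) I := fun i _ k _ hik => by
    simp only at hik
    omega
  refine (measureReal_biUnion_finset_le _ _).trans ((Finset.sum_le_sum fun i _ => ?_).trans
    (sum_pow_le_of_injOn (concentrationRate_pos K).le (concentrationRate_lt_one K) hinj hL))
  have hK := (ν i i).one_le_bound
  have hn : (1 : ℝ) ≤ n := mod_cast i.pos
  have hthreshold : 1 / (16 * K * n * √n) ≤ 1 / (2 * √n) := by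
    gcongr
    nlinarith
  refine le_trans ?_ (measureReal_rowHeight_lt_le_pow ν i)
  exact measureReal_mono (Set.ofPred_subset_ofPred.2 fun M hM => hM.trans_le hthreshold)

theorem measureReal_regularRows_inter_exists_late_rowHeight_lt_le (hN₀ : 0 < N) (hN : 4 * K * m ≤ N)
    (hI : ∀ i ∉ I, ∀ k ∈ I, k < i) {L : ℕ} (hL : Iᶜ.card ≤ L) (k : ℕ) :
    (matrixLaw ν).real
        (⋃ i ∈ Iᶜ, regularRows K m N I ∩ {M | rowHeight M i < 1 / (16 * K * n * √n)}) ≤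
      L * (1 / √(k + 1) + 2 ^ k * ((1 + concentrationRate K) / 2) ^ m) := by
  have := concentrationRate_pos K
  refine (measureReal_biUnion_finset_le _ _).trans
    ((Finset.sum_le_card_nsmul _ _ _ fun i hi =>
      measureReal_regularRows_inter_rowHeight_lt_le ν hN₀ hN
        (hI i (Finset.mem_compl.1 hi)) k).trans ?_)
  rw [nsmul_eq_mul]
  gcongr

theorem measureReal_exists_rowHeight_lt_le (hN₀ : 0 < N) (hN : 4 * K * m ≤ N) (L k : ℕ) :
    (matrixLaw ν).real {M | ∃ i, rowHeight M i < 1 / (16 * K * n * √n)} ≤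
      (n * (2 * N + 1)) ^ m * concentrationRate K ^ (n - L) +
        concentrationRate K ^ L / (1 - concentrationRate K) +
        L * (1 / √(k + 1) + 2 ^ k * ((1 + concentrationRate K) / 2) ^ m) := by
  set low : Fin n → Set (Fin n → Fin n → ℝ) := fun i => {M | rowHeight M i < 1 / (16 * K * n * √n)}
  set I := Finset.univ.filter fun i : Fin n => (i : ℕ) < n - L
  have hmem (i : Fin n) : i ∈ I ↔ (i : ℕ) < n - L := by simp [I]
  have hcard : I.card = n - L := Fin.card_filter_val_lt.trans (min_eq_right (Nat.sub_le _ _))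
  have hcover : {M | ∃ i, rowHeight M i < 1 / (16 * K * n * √n)} ⊆
      (regularRows K m N I)ᶜ ∪ (⋃ i ∈ I, low i) ∪ ⋃ i ∈ Iᶜ, regularRows K m N I ∩ low i := by
    rintro M ⟨i, hi⟩
    by_cases hM : M ∈ regularRows K m N I
    · by_cases hiI : i ∈ I
      · exact .inl (.inr (Set.mem_biUnion hiI hi))
      · exact .inr (Set.mem_biUnion (Finset.mem_compl.2 hiI) ⟨hM, hi⟩)
    · exact .inl (.inl hM)
  have hI (i : Fin n) (hi : i ∉ I) (l : Fin n) (hl : l ∈ I) : l < i := by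
    rw [hmem] at hi hl
    omega
  have hcompl : Iᶜ.card ≤ L := by
    rw [Finset.card_compl, Fintype.card_fin, hcard]
    omega
  calc _ ≤ _ := measureReal_mono hcover
    _ ≤ _ := measureReal_union_le _ _
    _ ≤ _ := add_le_add (measureReal_union_le _ _)
        (measureReal_regularRows_inter_exists_late_rowHeight_lt_le ν hN₀ hN hI hcompl k)
    _ ≤ _ := by
        rw [← hcard]
        gcongr
        · exact measureReal_compl_regularRows_le ν
        · exact measureReal_exists_early_rowHeight_lt_le ν fun i hi => by
            rw [hmem] at hi
            omega

end RowBounds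

section Deficiency

open StandardLaw

variable {n : ℕ} {K : ℝ}

/-- The total relative shortfall of the squared row heights of `M` below their expected values. -/
noncomputable def deficiency (M : Fin n → Fin n → ℝ) : ℝ := ∑ i, max 0 (rowDeficiency M i)

theorem measurable_deficiency : Measurable (deficiency (n := n)) :=
  Finset.measurable_sum _ fun i _ => measurable_const.max (measurable_rowDeficiency i)

theorem one_div_sqrt_succ_le (k : ℕ) : 1 / √(k + 1 : ℕ) ≤ 2 * √(k + 1 : ℕ) - 2 * √k := by
  have hsq : √(k : ℝ) ^ 2 = k := Real.sq_sqrt k.cast_nonneg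
  have hsq_succ : √(k + 1 : ℕ) ^ 2 = (k : ℝ) + 1 := by
    rw [Real.sq_sqrt (Nat.cast_nonneg _), Nat.cast_add_one]
  rw [div_le_iff₀ (by positivity)]
  nlinarith [sq_nonneg (√(k + 1 : ℕ) - √k)]

theorem sum_one_div_sqrt_le (n : ℕ) : ∑ i : Fin n, 1 / √(n - i : ℕ) ≤ 2 * √n := by
  rw [Fin.sum_univ_eq_sum_range (fun i => 1 / √(n - i : ℕ)), ← Finset.sum_range_reflect]
  calc ∑ i ∈ Finset.range n, 1 / √(n - (n - 1 - i) : ℕ)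
      = ∑ i ∈ Finset.range n, 1 / √(i + 1 : ℕ) := by
        refine Finset.sum_congr rfl fun i hi => ?_
        rw [show n - (n - 1 - i) = i + 1 by have := Finset.mem_range.1 hi; omega]
    _ ≤ ∑ i ∈ Finset.range n, (2 * √(i + 1 : ℕ) - 2 * √i) :=
        Finset.sum_le_sum fun i _ => one_div_sqrt_succ_le i
    _ = 2 * √n := by rw [Finset.sum_range_sub fun i : ℕ => 2 * √i]; simp

theorem lintegral_deficiency_le (ν : Fin n → Fin n → StandardLaw K) :
    ∫⁻ M, ENNReal.ofReal (deficiency M) ∂matrixLaw ν ≤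
      ENNReal.ofReal (√2 * |K| * (2 * √n)) := by
  have hofReal (M : Fin n → Fin n → ℝ) :
      ENNReal.ofReal (deficiency M) = ∑ i, ENNReal.ofReal (rowDeficiency M i) := by
    rw [deficiency, ENNReal.ofReal_sum_of_nonneg fun i _ => le_max_left _ _]
    simp only [ENNReal.ofReal_max, ENNReal.ofReal_zero, zero_le, sup_of_le_right]
  calc ∫⁻ M, ENNReal.ofReal (deficiency M) ∂matrixLaw ν
      = ∑ i, ∫⁻ M, ENNReal.ofReal (rowDeficiency M i) ∂matrixLaw ν := by
        simp_rw [hofReal]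
        exact lintegral_finsetSum _ fun i _ => (measurable_rowDeficiency i).ennreal_ofReal
    _ ≤ ∑ i : Fin n, ENNReal.ofReal (√2 * |K| / √(n - i : ℕ)) :=
        Finset.sum_le_sum fun i _ => lintegral_rowDeficiency_le ν i
    _ = ENNReal.ofReal (√2 * |K| * ∑ i : Fin n, 1 / √(n - i : ℕ)) := by
        rw [← ENNReal.ofReal_sum_of_nonneg fun i _ => by positivity, Finset.mul_sum]
        simp_rw [mul_one_div]
    _ ≤ ENNReal.ofReal (√2 * |K| * (2 * √n)) := by
        gcongr
        exact sum_one_div_sqrt_le n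

theorem measureReal_le_deficiency_le (ν : Fin n → Fin n → StandardLaw K) {t : ℝ} (ht : 0 < t) :
    (matrixLaw ν).real {M | t ≤ deficiency M} ≤ √2 * |K| * (2 * √n) / t := by
  refine ENNReal.toReal_le_of_le_ofReal (by positivity) ?_
  calc matrixLaw ν {M | t ≤ deficiency M}
      ≤ matrixLaw ν {M | ENNReal.ofReal t ≤ ENNReal.ofReal (deficiency M)} :=
        measure_mono fun M hM => ENNReal.ofReal_le_ofReal hM
    _ ≤ (∫⁻ M, ENNReal.ofReal (deficiency M) ∂matrixLaw ν) / ENNReal.ofReal t :=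
        meas_ge_le_lintegral_div measurable_deficiency.ennreal_ofReal.aemeasurable
          (by simpa using ht) ENNReal.ofReal_ne_top
    _ ≤ ENNReal.ofReal (√2 * |K| * (2 * √n) / t) := by
        rw [ENNReal.ofReal_div_of_pos ht]
        gcongr
        exact lintegral_deficiency_le ν

theorem exp_neg_mul_max_le {a y : ℝ} (ha : 0 < a) (ha₁ : a ≤ 1) (hy : a ≤ y) :
    Real.exp (-((2 * Real.log (1 / a) + 2) * max 0 (1 - y))) ≤ y := by
  have hy₀ : 0 < y := ha.trans_le hy
  have hlog : 0 ≤ Real.log (1 / a) := Real.log_nonneg ((one_le_div ha).2 ha₁)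
  rw [← Real.le_log_iff_exp_le hy₀]
  rcases le_total 1 y with h₁ | h₁
  · rw [max_eq_left (by linarith), mul_zero, neg_zero]
    exact Real.log_nonneg h₁
  rw [max_eq_right (by linarith)]
  rcases le_total (1 / 2) y with h₂ | h₂
  · have htangent : 1 - y⁻¹ ≤ Real.log y := Real.one_sub_inv_le_log_of_pos hy₀
    have hinv : y⁻¹ ≤ 3 - 2 * y := by
      rw [inv_le_iff_one_le_mul₀ hy₀]
      nlinarith
    nlinarith [mul_nonneg hlog (sub_nonneg.2 h₁)]
  · have hmono : Real.log a ≤ Real.log y := Real.log_le_log ha hy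
    rw [one_div, Real.log_inv] at hlog ⊢
    nlinarith

theorem factorial_eq_prod_sub (n : ℕ) : (n ! : ℝ) = ∏ i : Fin n, ((n - i : ℕ) : ℝ) := by
  rw [Fin.prod_univ_eq_prod_range (fun i => ((n - i : ℕ) : ℝ)), ← Finset.prod_range_reflect,
    ← Finset.prod_range_add_one_eq_factorial, Nat.cast_prod]
  refine Finset.prod_congr rfl fun i hi => ?_
  rw [show n - (n - 1 - i) = i + 1 by have := Finset.mem_range.1 hi; omega]

theorem exp_neg_mul_deficiency_le_prod {M : Fin n → Fin n → ℝ} {a : ℝ} (ha : 0 < a) (ha₁ : a ≤ 1)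
    (hM : ∀ i, a * n ≤ rowHeight M i ^ 2) :
    Real.exp (-((2 * Real.log (1 / a) + 2) * deficiency M)) ≤
      ∏ i, rowHeight M i ^ 2 / (n - i : ℕ) := by
  rw [deficiency, Finset.mul_sum, ← Finset.sum_neg_distrib, Real.exp_sum]
  refine Finset.prod_le_prod (fun i _ => (Real.exp_pos _).le) fun i _ =>
    exp_neg_mul_max_le ha ha₁ ?_
  rw [le_div_iff₀ (mod_cast Nat.sub_pos_of_lt i.2)]
  exact le_trans (by gcongr; exact Nat.sub_le _ _) (hM i)

theorem sqrt_factorial_mul_exp_neg_le_abs_det {M : Fin n → Fin n → ℝ} {a : ℝ} (ha : 0 < a)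
    (ha₁ : a ≤ 1) (hM : ∀ i, a * n ≤ rowHeight M i ^ 2) :
    √(n ! : ℝ) * Real.exp (-((Real.log (1 / a) + 1) * deficiency M)) ≤ |(Matrix.of M).det| := by
  have hfactorial : (0 : ℝ) < n ! := mod_cast n.factorial_pos
  refine le_of_sq_le_sq ?_ (abs_nonneg _)
  calc (√(n ! : ℝ) * Real.exp (-((Real.log (1 / a) + 1) * deficiency M))) ^ 2
      = n ! * Real.exp (-((2 * Real.log (1 / a) + 2) * deficiency M)) := by
        rw [mul_pow, Real.sq_sqrt hfactorial.le, ← Real.exp_nat_mul]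
        ring_nf
    _ ≤ n ! * ∏ i, rowHeight M i ^ 2 / (n - i : ℕ) := by
        gcongr
        exact exp_neg_mul_deficiency_le_prod ha ha₁ hM
    _ = |(Matrix.of M).det| ^ 2 := by
        rw [abs_det_eq_prod_rowHeight, Finset.prod_div_distrib, Finset.prod_pow,
          ← factorial_eq_prod_sub, mul_div_cancel₀ _ hfactorial.ne']

end Deficiency

section Asymptotics

open StandardLaw

theorem tendsto_pow_mul_pow_sub {p : ℝ} (hp₀ : 0 < p) (hp₁ : p < 1) (m L : ℕ) :
    Tendsto (fun n : ℕ => (n : ℝ) ^ m * p ^ (n - L)) atTop (𝓝 0) := by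
  have hlim := (tendsto_pow_const_mul_const_pow_of_lt_one m hp₀.le hp₁).div_const (p ^ L)
  rw [zero_div] at hlim
  refine hlim.congr' ?_
  filter_upwards [eventually_ge_atTop L] with n hn
  rw [pow_sub₀ p hp₀.ne' hn, ← div_eq_mul_inv, mul_div_assoc]

theorem exists_one_div_sqrt_add_le {p κ : ℝ} (hp₀ : 0 ≤ p) (hp₁ : p < 1) (hκ : 0 < κ) :
    ∃ k m : ℕ, 1 / √((k : ℝ) + 1) + 2 ^ k * p ^ m ≤ κ := by
  have hsqrt : Tendsto (fun k : ℕ => 1 / √((k : ℝ) + 1)) atTop (𝓝 0) :=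
    (Real.tendsto_sqrt_atTop.comp
      (tendsto_atTop_add_const_right _ 1 tendsto_natCast_atTop_atTop)).const_div_atTop 1
  obtain ⟨k, hk⟩ := (hsqrt.eventually_le_const (half_pos hκ)).exists
  have hpow := (tendsto_pow_atTop_nhds_zero_of_lt_one hp₀ hp₁).const_mul ((2 : ℝ) ^ k)
  rw [mul_zero] at hpow
  obtain ⟨m, hm⟩ := (hpow.eventually_le_const (half_pos hκ)).exists
  exact ⟨k, m, by linarith⟩

theorem exists_pow_div_one_sub_le {p κ : ℝ} (hp₀ : 0 ≤ p) (hp₁ : p < 1) (hκ : 0 < κ) :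
    ∃ L : ℕ, p ^ L / (1 - p) ≤ κ := by
  have hlim := (tendsto_pow_atTop_nhds_zero_of_lt_one hp₀ hp₁).div_const (1 - p)
  rw [zero_div] at hlim
  exact (hlim.eventually_le_const hκ).exists

theorem eventually_log_mul_pow_add_one_le_rpow {c s : ℝ} (hc : c ≠ 0) (hs : 0 < s) (k : ℕ) :
    ∀ᶠ x : ℝ in atTop, Real.log (c * x ^ k) + 1 ≤ x ^ s := by
  have hconst : (fun _ : ℝ => Real.log c + 1) =o[atTop] fun x => x ^ s :=
    Asymptotics.isLittleO_const_left.2 <| Or.inr <|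
      tendsto_norm_atTop_atTop.comp (tendsto_rpow_atTop hs)
  have hsum := hconst.add ((isLittleO_log_rpow_atTop hs).const_mul_left (k : ℝ))
  filter_upwards [hsum.bound one_pos, eventually_gt_atTop 0] with x hx hx₀
  rw [Real.norm_of_nonneg (Real.rpow_pos_of_pos hx₀ s).le, one_mul] at hx
  rw [Real.log_mul hc (by positivity), Real.log_pow]
  linarith [le_of_abs_le hx]

theorem tendsto_const_mul_sqrt_div_rpow {s : ℝ} (hs : 0 < s) (C : ℝ) :
    Tendsto (fun x : ℝ => C * √x / x ^ (1 / 2 + s)) atTop (𝓝 0) := by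
  have hlim := (tendsto_rpow_neg_atTop hs).const_mul C
  rw [mul_zero] at hlim
  refine hlim.congr' ?_
  filter_upwards [eventually_gt_atTop 0] with x hx
  rw [Real.rpow_add hx, Real.sqrt_eq_rpow, Real.rpow_neg hx.le]
  have : 0 < x ^ (1 / 2 : ℝ) := Real.rpow_pos_of_pos hx _
  field_simp

variable {ε κ : ℝ}

theorem eventually_measureReal_exists_rowHeight_lt_le (K : ℝ) (hκ : 0 < κ) :
    ∀ᶠ n : ℕ in atTop, ∀ ν : Fin n → Fin n → StandardLaw K,
      (matrixLaw ν).real {M | ∃ i, rowHeight M i < 1 / (16 * K * n * √n)} ≤ κ := by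
  have hp₀ := concentrationRate_pos K
  have hp₁ := concentrationRate_lt_one K
  obtain ⟨L, hL⟩ := exists_pow_div_one_sub_le hp₀.le hp₁ (show 0 < κ / 3 by positivity)
  obtain ⟨k, m, hkm⟩ := exists_one_div_sqrt_add_le
    (p := (1 + concentrationRate K) / 2) (by linarith) (by linarith)
    (show 0 < κ / 3 / (L + 1) by positivity)
  have hlast : L * (1 / √((k : ℝ) + 1) + 2 ^ k * ((1 + concentrationRate K) / 2) ^ m) ≤ κ / 3 :=
    calc _ ≤ (L + 1) * (κ / 3 / (L + 1)) := by gcongr; linarith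
      _ = κ / 3 := mul_div_cancel₀ _ (by positivity)
  obtain ⟨N, hN₀, hN⟩ : ∃ N : ℕ, 0 < N ∧ 4 * K * m ≤ N :=
    ⟨⌈4 * K * m⌉₊ + 1, Nat.succ_pos _, (Nat.le_ceil _).trans (mod_cast Nat.le_succ _)⟩
  have hunion := (tendsto_pow_mul_pow_sub hp₀ hp₁ m L).const_mul ((2 * N + 1 : ℝ) ^ m)
  rw [mul_zero] at hunion
  filter_upwards [hunion.eventually_le_const (show 0 < κ / 3 by positivity)] with n hn ν
  have hbound := measureReal_exists_rowHeight_lt_le ν hN₀ hN L k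
  rw [mul_pow] at hbound
  linarith

theorem eventually_measureReal_le_deficiency_le (K : ℝ) (hε : 0 < ε) (hκ : 0 < κ) :
    ∀ᶠ n : ℕ in atTop, ∀ ν : Fin n → Fin n → StandardLaw K,
      (matrixLaw ν).real {M | (n : ℝ) ^ (1 / 2 + ε) ≤ deficiency M} ≤ κ := by
  have hlim := (tendsto_const_mul_sqrt_div_rpow hε (√2 * |K| * 2)).comp
    tendsto_natCast_atTop_atTop
  filter_upwards [hlim.eventually_le_const hκ, eventually_gt_atTop 0] with n hn hn₀ ν
  have hpos : (0 : ℝ) < (n : ℝ) ^ (1 / 2 + ε) := Real.rpow_pos_of_pos (mod_cast hn₀) _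
  exact (measureReal_le_deficiency_le ν hpos).trans (by rwa [← mul_assoc])

theorem eventually_sqrt_factorial_mul_exp_neg_rpow_le_abs_det {K : ℝ} (hK : 1 ≤ K) (hε : 0 < ε) :
    ∀ᶠ n : ℕ in atTop, ∀ M : Fin n → Fin n → ℝ,
      (∀ i, 1 / (16 * K * n * √n) ≤ rowHeight M i) → deficiency M ≤ (n : ℝ) ^ (1 / 2 + ε / 2) →
      √(n ! : ℝ) * Real.exp (-(n : ℝ) ^ (1 / 2 + ε)) ≤ |(Matrix.of M).det| := by
  have hlog := tendsto_natCast_atTop_atTop.eventually <|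
    eventually_log_mul_pow_add_one_le_rpow (c := 256 * K ^ 2) (by positivity) (half_pos hε) 4
  filter_upwards [hlog, eventually_ge_atTop 1] with n hlog hn₁ M hheight hdef
  have hn : (1 : ℝ) ≤ n := mod_cast hn₁
  have hheight_sq (i : Fin n) : 1 / (256 * K ^ 2 * (n : ℝ) ^ 4) * n ≤ rowHeight M i ^ 2 :=
    calc 1 / (256 * K ^ 2 * (n : ℝ) ^ 4) * n = (1 / (16 * K * n * √n)) ^ 2 := by
          rw [div_pow, mul_pow, mul_pow, mul_pow, Real.sq_sqrt n.cast_nonneg]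
          field_simp
          norm_num
      _ ≤ rowHeight M i ^ 2 := pow_le_pow_left₀ (by positivity) (hheight i) 2
  have hscale : 1 ≤ 256 * K ^ 2 * (n : ℝ) ^ 4 := by
    nlinarith [one_le_pow₀ hK (n := 2), one_le_pow₀ hn (n := 4)]
  refine le_trans ?_ (sqrt_factorial_mul_exp_neg_le_abs_det (by positivity)
    ((div_le_one (by positivity)).2 hscale) hheight_sq)
  rw [one_div_one_div]
  gcongr
  calc (Real.log (256 * K ^ 2 * (n : ℝ) ^ 4) + 1) * deficiency M
      ≤ (n : ℝ) ^ (ε / 2) * (n : ℝ) ^ (1 / 2 + ε / 2) :=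
        mul_le_mul hlog hdef (Finset.sum_nonneg fun _ _ => le_max_left _ _) (by positivity)
    _ = (n : ℝ) ^ (1 / 2 + ε) := by
        rw [← Real.rpow_add (by positivity)]
        ring_nf

theorem eventually_measureReal_abs_det_lt_le (K : ℝ) (hε : 0 < ε) (hκ : 0 < κ) :
    ∀ᶠ n : ℕ in atTop, ∀ ν : Fin n → Fin n → StandardLaw K,
      (matrixLaw ν).real
        {M | |(Matrix.of M).det| < √(n ! : ℝ) * Real.exp (-(n : ℝ) ^ (1 / 2 + ε))} ≤ κ := by
  rcases lt_or_ge K 1 with hK | hK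
  · filter_upwards [eventually_gt_atTop 0] with n hn ν
    exact absurd (ν ⟨0, hn⟩ ⟨0, hn⟩).one_le_bound hK.not_ge
  filter_upwards [eventually_measureReal_exists_rowHeight_lt_le K (half_pos hκ),
    eventually_measureReal_le_deficiency_le K (half_pos hε) (half_pos hκ),
    eventually_sqrt_factorial_mul_exp_neg_rpow_le_abs_det hK hε] with n hheight hdef hdet ν
  have hcover : {M : Fin n → Fin n → ℝ |
      |(Matrix.of M).det| < √(n ! : ℝ) * Real.exp (-(n : ℝ) ^ (1 / 2 + ε))} ⊆
      {M | ∃ i, rowHeight M i < 1 / (16 * K * n * √n)} ∪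
        {M | (n : ℝ) ^ (1 / 2 + ε / 2) ≤ deficiency M} := by
    intro M hM
    by_contra! hgood
    simp only [Set.mem_union, Set.mem_ofPred_eq, not_or, not_exists, not_lt, not_le] at hgood
    exact hM.not_ge (hdet M hgood.1 hgood.2.le)
  calc _ ≤ _ := measureReal_mono hcover
    _ ≤ _ := measureReal_union_le _ _
    _ ≤ κ / 2 + κ / 2 := add_le_add (hheight ν) (hdef ν)
    _ = κ := add_halves κ

end Asymptotics

theorem tendsto_iSup_nhds_zero {ι : Type*} {α : ι → Type*} {l : Filter ι} {f : ∀ i, α i → ℝ}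
    (hf₀ : ∀ i a, 0 ≤ f i a) (hf : ∀ κ > 0, ∀ᶠ i in l, ∀ a, f i a ≤ κ) :
    Tendsto (fun i => ⨆ a, f i a) l (𝓝 0) := by
  refine tendsto_order.2 ⟨fun b hb => .of_forall fun i => hb.trans_le (Real.iSup_nonneg (hf₀ i)),
    fun b hb => ?_⟩
  filter_upwards [hf (b / 2) (half_pos hb)] with i hi
  exact (Real.iSup_le hi (half_pos hb).le).trans_lt (half_lt_self hb)

section Transfer

open StandardLaw

variable {Ω : Type*} [MeasurableSpace Ω] {μ : Measure Ω} [IsProbabilityMeasure μ] {K : ℝ}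

/-- The law of a standardised bounded random variable, as a `StandardLaw`. -/
noncomputable def StandardLaw.map {X : Ω → ℝ} (hX : Measurable X) (hmean : ∫ ω, X ω ∂μ = 0)
    (hvar : variance X μ = 1) (hbound : ∀ᵐ ω ∂μ, |X ω| ≤ K) : StandardLaw K where
  toMeasure := μ.map X
  isProbabilityMeasure := Measure.isProbabilityMeasure_map hX.aemeasurable
  ae_abs_le :=
    (ae_map_iff hX.aemeasurable (measurableSet_le (by fun_prop) (by fun_prop))).2 hbound
  integral_id_eq_zero := by rwa [integral_map hX.aemeasurable (by fun_prop)]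
  integral_sq_eq_one := by
    rwa [integral_map hX.aemeasurable (by fun_prop),
      ← variance_of_integral_eq_zero hX.aemeasurable hmean]

theorem map_eq_pi_pi_of_iIndepFun {ι κ : Type*} [Fintype ι] [Fintype κ] {E : Type*}
    [MeasurableSpace E] {ξ : ι → κ → Ω → E} (hm : ∀ i j, Measurable (ξ i j))
    (hind : iIndepFun (fun p : ι × κ => ξ p.1 p.2) μ) :
    μ.map (fun ω i j => ξ i j ω) = Measure.pi fun i => Measure.pi fun j => μ.map (ξ i j) := by
  have (i : ι) (j : κ) : IsProbabilityMeasure (μ.map (ξ i j)) :=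
    Measure.isProbabilityMeasure_map (hm i j).aemeasurable
  have hprod : μ.map (fun ω (p : ι × κ) => ξ p.1 p.2 ω) =
      Measure.pi fun p : ι × κ => μ.map (ξ p.1 p.2) :=
    hind.map_fun_eq_pi_map fun p => (hm p.1 p.2).aemeasurable
  calc μ.map (fun ω i j => ξ i j ω)
      = (μ.map fun ω (p : ι × κ) => ξ p.1 p.2 ω).map (MeasurableEquiv.curry ι κ E) := by
        rw [Measure.map_map (MeasurableEquiv.measurable _) (by fun_prop)]
        rfl
    _ = Measure.pi fun i => Measure.pi fun j => μ.map (ξ i j) := by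
        simp_rw [hprod, ← Measure.infinitePi_eq_pi]
        exact Measure.infinitePi_map_curry fun i j => μ.map (ξ i j)

theorem one_sub_iSup_measureReal_matrixLaw_le
    {ι κ : Type*} [Fintype ι] [Fintype κ] {ξ : ι → κ → Ω → ℝ}
    (hm : ∀ i j, Measurable (ξ i j)) (hind : iIndepFun (fun p : ι × κ => ξ p.1 p.2) μ)
    (hmean : ∀ i j, ∫ ω, ξ i j ω ∂μ = 0) (hvar : ∀ i j, variance (ξ i j) μ = 1)
    (hbound : ∀ i j, ∀ᵐ ω ∂μ, |ξ i j ω| ≤ K) {S : Set (ι → κ → ℝ)} (hS : MeasurableSet S) :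
    1 - (⨆ ν : ι → κ → StandardLaw K, (matrixLaw ν).real Sᶜ) ≤
      μ.real {ω | (fun i j => ξ i j ω) ∈ S} := by
  have hmeas : Measurable fun ω i j => ξ i j ω := by fun_prop
  have hlaw : μ.map (fun ω i j => ξ i j ω) =
      matrixLaw fun i j => .map (hm i j) (hmean i j) (hvar i j) (hbound i j) :=
    map_eq_pi_pi_of_iIndepFun hm hind
  have hprob : μ.real {ω | (fun i j => ξ i j ω) ∈ S} =
      1 - (μ.map (fun ω i j => ξ i j ω)).real Sᶜ := by
    rw [map_measureReal_apply hmeas hS.compl, Set.preimage_compl,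
      probReal_compl_eq_one_sub (hmeas hS), sub_sub_cancel]
    rfl
  rw [hprob, hlaw]
  refine sub_le_sub_left (le_ciSup (f := fun ν : ι → κ → StandardLaw K => (matrixLaw ν).real Sᶜ)
    ⟨1, ?_⟩ _) 1
  rintro _ ⟨ν, rfl⟩
  exact measureReal_le_one

theorem measurable_abs_det {n : ℕ} :
    Measurable fun M : Fin n → Fin n → ℝ => |(Matrix.of M).det| :=
  have : Continuous fun M : Fin n → Fin n → ℝ => |(Matrix.of M).det| :=
    (Continuous.matrix_det continuous_id).abs
  this.measurable

end Transfer

theorem theorem7p6 (K : ℝ) (ε : ℝ) (hε : 0 < ε) :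
    ∃ δ : ℕ → ℝ, Tendsto δ atTop (𝓝 0) ∧
      ∀ (n : ℕ) (Ω : Type*) [MeasurableSpace Ω] (μ : Measure Ω) [IsProbabilityMeasure μ]
        (ξ : Fin n → Fin n → Ω → ℝ),
        (∀ i j, Measurable (ξ i j)) →
        iIndepFun (fun p : Fin n × Fin n => ξ p.1 p.2) μ →
        (∀ i j, ∫ ω, ξ i j ω ∂μ = 0) →
        (∀ i j, variance (ξ i j) μ = 1) →
        (∀ i j, ∀ᵐ ω ∂μ, |ξ i j ω| ≤ K) →
        1 - δ n ≤ μ.real {ω | Real.sqrt (n ! : ℝ) * Real.exp (-(n : ℝ) ^ (1 / 2 + ε)) ≤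
          |(Matrix.of fun i j => ξ i j ω).det|} := by
  let largeDet (n : ℕ) : Set (Fin n → Fin n → ℝ) :=
    {M | √(n ! : ℝ) * Real.exp (-(n : ℝ) ^ (1 / 2 + ε)) ≤ |(Matrix.of M).det|}
  refine ⟨fun n => ⨆ ν : Fin n → Fin n → StandardLaw K,
      (StandardLaw.matrixLaw ν).real (largeDet n)ᶜ,
    tendsto_iSup_nhds_zero (fun _ _ => measureReal_nonneg) fun κ hκ => ?_,
    fun n Ω _ μ _ ξ hm hind hmean hvar hbound => ?_⟩
  · filter_upwards [eventually_measureReal_abs_det_lt_le K hε hκ] with n hn ν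
    simpa only [largeDet, Set.compl_ofPred, not_le] using hn ν
  · exact one_sub_iSup_measureReal_matrixLaw_le hm hind hmean hvar hbound
      (measurableSet_le measurable_const measurable_abs_det)
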